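/- Let $\mathrm{Triangle}(n)$ be the triangular board with $n$ holes on each side, i.e. the $T(n)=n(n+1)/2$ points of an equilateral triangle in the triangular lattice. A jump takes a peg over a peg in an adjacent hole (in one of the six lattice directions) into the next hole on the same line, which must be an empty hole of the board, and removes (captures) the peg jumped over. A peg solitaire problem on the board is given by a starting vacancy $v$ and a finishing location $f$; a solution of it is a sequence of jumps leading from the position with a peg in every hole except $v$ to the position whose only peg is in $f$. A maximal run of consecutive jumps made by the same peg counts as one move; the length of a solution is its number of moves, and its average is the number of pegs captured divided by the number of moves. A shortest solution on $\mathrm{Triangle}(n)$ is a solution, of some peg solitaire problem on $\mathrm{Triangle}(n)$, with the least number of moves among all solutions of all peg solitaire problems on $\mathrm{Triangle}(n)$. Then: 1. For every $n$, every solution of every peg solitaire problem on $\mathrm{Triangle}(n)$ has at least $T(n)/7$ moves, and hence captures at most $7$ pegs per move on average. 2. For every $i\ge 1$ there is a peg solitaire problem on $\mathrm{Triangle}(12i)$ (a board with $72i^2+6i$ holes) with a solution of length exactly $18i^2+14i-3$; the averages of these solutions tend to $4$ as $i\to\infty$. 3. Consequently, on large triangular boards the shortest solutions average asymptotically between $4$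 and $7$ captures per move: for every $\varepsilon>0$ there is an $N$ such that for all $n\ge N$ a shortest solution on $\mathrm{Triangle}(n)$ exists, and the average $a$ of every shortest solution on $\mathrm{Triangle}(n)$ satisfies $4-\varepsilon\le a\le 7$. -/

import Mathlib

open Filter Topology

/-- The triangular peg solitaire game on boards of arbitrary side.  A hole is a pair
`(r, c)`: row `r` counted from the top corner, position `c` within the row counted from the
left edge, both starting at `0`.  The top corner is `(0, 0)` and row `r` has the holes
`(r, 0), …, (r, r)`. -/
abbrev Hole : Type := ℤ × ℤ

namespace PegSolitaire

/-- The holes of `Triangle(n)`, the triangular board of side `n`. -/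
noncomputable def triangle (n : ℕ) : Finset Hole :=
  (Finset.Ico (0 : ℤ) n ×ˢ Finset.Ico (0 : ℤ) n).filter fun p => p.2 ≤ p.1

/-- The six directions of the triangular lattice in these coordinates: right, left,
down-left, up-right, down-right, up-left. -/
def directions : Finset (ℤ × ℤ) :=
  {(0, 1), (0, -1), (1, 0), (-1, 0), (1, 1), (-1, -1)}

/-- A jump: the hole in which the jumping peg stands and the direction in which it jumps. -/
structure Jump where
  src : Hole
  dir : ℤ × ℤ

/-- The hole that is jumped over. -/
def Jump.over (j : Jump) : Hole := j.src + j.dir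

/-- The hole in which the jumping peg lands. -/
def Jump.tgt (j : Jump) : Hole := j.src + j.dir + j.dir

/-- The jump `j` is allowed on `Triangle(n)` when the set of holes occupied by pegs is `B`. -/
def Jump.Legal (n : ℕ) (B : Finset Hole) (j : Jump) : Prop :=
  j.dir ∈ directions ∧ j.src ∈ B ∧ j.over ∈ B ∧ j.tgt ∈ triangle n ∧ j.tgt ∉ B

/-- The set of occupied holes after the jump `j` from the position `B`. -/
def Jump.result (B : Finset Hole) (j : Jump) : Finset Hole :=
  insert j.tgt ((B.erase j.src).erase j.over)

/-- `Plays n B l B'`: on `Triangle(n)` the jumps of the list `l`, executed one after the other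
from the position `B`, are all allowed and lead to the position `B'`. -/
inductive Plays (n : ℕ) : Finset Hole → List Jump → Finset Hole → Prop
  | nil (B : Finset Hole) : Plays n B [] B
  | cons {B B' : Finset Hole} {j : Jump} {l : List Jump}
      (hj : j.Legal n B) (hl : Plays n (j.result B) l B') : Plays n B (j :: l) B'

/-- `l` is a solution of the peg solitaire problem on `Triangle(n)` with starting vacancy `v`
and finishing location `f`: it leads from the position with a peg in every hole except `v` to
the position whose only peg is in `f`. -/
def IsSolution (n : ℕ) (v f : Hole) (l : List Jump) : Prop :=
  v ∈ triangle n ∧ f ∈ triangle n ∧ Plays n ((triangle n).erase v) l {f}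

/-- The number of moves of a sequence of jumps, where consecutive jumps of the same peg make
up a single move.  A jump is made by the same peg as the jump just before it exactly when it
starts from the hole in which that jump landed. -/
def numMoves : List Jump → ℕ
  | [] => 0
  | [_] => 1
  | a :: b :: l => (if b.src = a.tgt then 0 else 1) + numMoves (b :: l)

/-- The average number of pegs captured per move: every jump captures exactly one peg. -/
noncomputable def avgCaptures (l : List Jump) : ℝ := (l.length : ℝ) / (numMoves l : ℝ)

/-- `l` solves some peg solitaire problem on `Triangle(n)`, and no solution of any peg
solitaire problem on `Triangle(n)` has fewer moves. -/
def IsShortestOn (n : ℕ) (l : List Jump) : Prop :=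
  (∃ v f, IsSolution n v f l) ∧
    ∀ v f l', IsSolution n v f l' → numMoves l ≤ numMoves l'

end PegSolitaire

/-! Lower bound. A lattice point and its six neighbours form a hexagon, and the hexagons whose
centres lie in one residue class of `r + 2c` mod 7 tile the lattice. As long as a tile, cut down to
the board, is full, no jump lands in it, and a jump over one of its pegs starts or ends in it. So
the first jump to disturb it starts inside it, and this jump begins a move, because the jump before
it did not land there. A jump starts in only one tile, so every tile that is full at first and empty
in the end costs a move of its own (`card_le_movesAfter`). There are T(n) + 3n + 3 hexagons that
meet the board; pigeonhole gives a class large enough to afford the loss of the two tiles containing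
the starting vacancy and the finishing hole (`IsSolution.card_le_seven_mul`).

Construction. On a board of side 2m, 3 ∣ m, the holes with both coordinates even form a triangular
grid, and every hole outside the bottom row that is not of this kind is the midpoint of an edge of
that grid. Vacancies walking along the right side and the even columns empty the grid at one capture
per move, about T/4 moves (`Reach.walk`). A single peg on the grid can then capture the edge pegs in
one long move that follows an Euler trail: along the right border, then alternately zigzagging up
and running straight down, line after line (`reach_lines`). So about T/4 moves make about T
captures, an average near 4. Opening, top corner and right border need finite patterns of jumps,
checked by computation and translated (`plays_of_runLocal`); the right border has period six, whence
3 ∣ m. A parameter `s` lengthens the solution in steps of one move (`exists_solution_six_mul`).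

All boards. From a suitable vacancy, the last rows of any board of side n ≥ 20 can be stripped, at
most seven in all, down to a `Triangle(6K)` with the vacancy the construction needs
(`exists_reduces_six_mul`). This costs O(n) moves, so a shortest solution has at most n²/8 + O(n)
moves for about n²/2 captures. -/

namespace PegSolitaire

/-! ### Counting moves, composing plays, positions given by predicates -/

/-- The number of moves begun by the jumps of a list, when the jump before the list landed
in `p`. -/
def movesAfter : Option Hole → List Jump → ℕ
  | _, [] => 0
  | p, j :: l => (if p = some j.src then 0 else 1) + movesAfter (some j.tgt) l

/-- The hole in which the last jump of a list lands, when the jump before the list landed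
in `p`. -/
def lastLanding : Option Hole → List Jump → Option Hole
  | p, [] => p
  | _, j :: l => lastLanding (some j.tgt) l

theorem numMoves_cons (a : Jump) (l : List Jump) :
    numMoves (a :: l) = 1 + movesAfter (some a.tgt) l := by
  induction l generalizing a with
  | nil => rfl
  | cons b l ih =>
    rw [numMoves, ih, movesAfter]
    by_cases h : b.src = a.tgt
    · simp [h]
    · simp [h, Ne.symm h]

theorem numMoves_eq_movesAfter (l : List Jump) : numMoves l = movesAfter none l := by
  cases l with
  | nil => rfl
  | cons a l => rw [numMoves_cons, movesAfter]; simp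

theorem movesAfter_append (p : Option Hole) (l l' : List Jump) :
    movesAfter p (l ++ l') = movesAfter p l + movesAfter (lastLanding p l) l' := by
  induction l generalizing p with
  | nil => simp [movesAfter, lastLanding]
  | cons a l ih => simp [movesAfter, lastLanding, ih, add_assoc]

theorem lastLanding_append (p : Option Hole) (l l' : List Jump) :
    lastLanding p (l ++ l') = lastLanding (lastLanding p l) l' := by
  induction l generalizing p with
  | nil => simp [lastLanding]
  | cons a l ih => simp [lastLanding, ih]

theorem Plays.append {n : ℕ} {B C D : Finset Hole} {l l' : List Jump}
    (h : Plays n B l C) (h' : Plays n C l' D) : Plays n B (l ++ l') D := by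
  induction h with
  | nil => exact h'
  | cons hj _ ih => exact Plays.cons hj (ih h')

/-- `Reach n B p k B' p'`: from the position `B`, in which the last jump landed in `p`, the
position `B'` can be reached by jumps that begin exactly `k` moves, the last one landing
in `p'`. -/
def Reach (n : ℕ) (B : Finset Hole) (p : Option Hole) (k : ℕ) (B' : Finset Hole)
    (p' : Option Hole) : Prop :=
  ∃ l, Plays n B l B' ∧ movesAfter p l = k ∧ lastLanding p l = p'

theorem some_hole_congr {a b c d : ℤ} (h : a = c) (h' : b = d) :
    (some (a, b) : Option Hole) = some (c, d) := by rw [h, h']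

theorem Reach.refl (n : ℕ) (B : Finset Hole) (p : Option Hole) : Reach n B p 0 B p :=
  ⟨[], Plays.nil B, rfl, rfl⟩

theorem Reach.trans {n : ℕ} {B C D : Finset Hole} {p q r : Option Hole} {k k' : ℕ}
    (h : Reach n B p k C q) (h' : Reach n C q k' D r) : Reach n B p (k + k') D r := by
  obtain ⟨l, h1, h2, h3⟩ := h
  obtain ⟨l', h1', h2', h3'⟩ := h'
  refine ⟨l ++ l', h1.append h1', ?_, ?_⟩
  · rw [movesAfter_append, h2, h3, h2']
  · rw [lastLanding_append, h3, h3']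

theorem Reach.iterate {n : ℕ} (B : ℕ → Finset Hole) (p : ℕ → Option Hole) (k K : ℕ)
    (h : ∀ i < K, Reach n (B i) (p i) k (B (i + 1)) (p (i + 1))) :
    Reach n (B 0) (p 0) (K * k) (B K) (p K) := by
  induction K with
  | zero => simpa using Reach.refl n (B 0) (p 0)
  | succ K ih =>
    rw [Nat.succ_mul]
    exact (ih fun i hi => h i (by omega)).trans (h K (by omega))

/-- The position of the holes of the board at which `P` holds. -/
noncomputable def board (n : ℕ) (P : ℤ → ℤ → Prop) : Finset Hole :=
  open Classical in (triangle n).filter fun x => P x.1 x.2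

theorem mem_triangle {n : ℕ} {r c : ℤ} : (r, c) ∈ triangle n ↔ 0 ≤ c ∧ c ≤ r ∧ r < n := by
  simp only [triangle, Finset.mem_filter, Finset.mem_product, Finset.mem_Ico]
  omega

theorem mem_board {n : ℕ} {P : ℤ → ℤ → Prop} {r c : ℤ} :
    (r, c) ∈ board n P ↔ (0 ≤ c ∧ c ≤ r ∧ r < n) ∧ P r c := by
  simp only [board, Finset.mem_filter, mem_triangle]

theorem board_congr {n : ℕ} {P Q : ℤ → ℤ → Prop}
    (h : ∀ r c : ℤ, 0 ≤ c → c ≤ r → r < n → (P r c ↔ Q r c)) : board n P = board n Q := by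
  ext ⟨r, c⟩
  rw [mem_board, mem_board]
  exact and_congr_right fun hx => h r c hx.1 hx.2.1 hx.2.2

/-- With positions given by predicates on the coordinates, legality and the resulting position
become linear arithmetic over the integers. -/
theorem Reach.jump {n : ℕ} {P Q : ℤ → ℤ → Prop} {p : Option Hole} {k : ℕ} (r c dr dc : ℤ)
    (hd : (dr, dc) ∈ directions) (hk : (if p = some (r, c) then 0 else 1) = k)
    (hs : 0 ≤ c ∧ c ≤ r ∧ r < n ∧ P r c) (ho : P (r + dr) (c + dc))
    (ht : 0 ≤ c + 2 * dc ∧ c + 2 * dc ≤ r + 2 * dr ∧ r + 2 * dr < n ∧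
      ¬ P (r + 2 * dr) (c + 2 * dc))
    (hQ : ∀ x y : ℤ, 0 ≤ y → y ≤ x → x < n → (Q x y ↔ (x = r + 2 * dr ∧ y = c + 2 * dc) ∨
      (P x y ∧ ¬ (x = r ∧ y = c) ∧ ¬ (x = r + dr ∧ y = c + dc)))) :
    Reach n (board n P) p k (board n Q) (some (r + 2 * dr, c + 2 * dc)) := by
  have et : (⟨(r, c), (dr, dc)⟩ : Jump).tgt = (r + 2 * dr, c + 2 * dc) := by
    ext <;> simp [Jump.tgt] <;> ring
  have eo : (⟨(r, c), (dr, dc)⟩ : Jump).over = (r + dr, c + dc) := rfl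
  refine ⟨[⟨(r, c), (dr, dc)⟩], Plays.cons ?_ ?_, ?_, ?_⟩
  · refine ⟨hd, mem_board.2 ⟨⟨hs.1, hs.2.1, hs.2.2.1⟩, hs.2.2.2⟩, ?_, ?_, ?_⟩
    · rw [eo]
      exact mem_board.2 ⟨by omega, ho⟩
    · rw [et]
      exact mem_triangle.2 ⟨ht.1, ht.2.1, ht.2.2.1⟩
    · rw [et, mem_board]
      exact fun h => ht.2.2.2 h.2
  · have : Jump.result (board n P) ⟨(r, c), (dr, dc)⟩ = board n Q := by
      ext ⟨x, y⟩
      rw [Jump.result, et, eo, Finset.mem_insert, Finset.mem_erase, Finset.mem_erase, mem_board,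
        mem_board]
      simp only [ne_eq, Prod.mk.injEq]
      constructor
      · rintro (h | h)
        · exact ⟨by omega, (hQ x y (by omega) (by omega) (by omega)).2 (Or.inl h)⟩
        · exact ⟨h.2.2.1, (hQ x y (by omega) (by omega) (by omega)).2
            (Or.inr ⟨h.2.2.2, h.2.1, h.1⟩)⟩
      · rintro ⟨hx, h⟩
        rcases (hQ x y hx.1 hx.2.1 hx.2.2).1 h with h | h
        · exact Or.inl h
        · exact Or.inr ⟨h.2.2, h.2.1, hx, h.1⟩
    rw [this]
    exact Plays.nil _
  · simpa [movesAfter] using hk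
  · simp [lastLanding, et]

/-! ### Finite patterns of jumps and their translates -/

/-- The result of a list of jumps from the position `S` on a patch `W` of holes, if they are
all allowed. -/
def runLocal (W : List Hole) : List Hole → List Jump → Option (List Hole)
  | S, [] => some S
  | S, j :: l =>
    if j.dir ∈ directions ∧ j.src ∈ S ∧ j.over ∈ S ∧ j.over ∈ W ∧ j.src ∈ W ∧
        j.tgt ∈ W ∧ j.tgt ∉ S then
      runLocal W (j.tgt :: S.filter fun x => x ≠ j.src ∧ x ≠ j.over) l
    else none

/-- A jump moved by the vector `o`. -/
def Jump.shift (o : Hole) (j : Jump) : Jump := ⟨j.src + o, j.dir⟩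

theorem Jump.tgt_shift (o : Hole) (j : Jump) : (j.shift o).tgt = j.tgt + o := by
  simp only [Jump.shift, Jump.tgt]; abel

theorem Jump.over_shift (o : Hole) (j : Jump) : (j.shift o).over = j.over + o := by
  simp only [Jump.shift, Jump.over]; abel

theorem movesAfter_shift (o t : Hole) (l : List Jump) :
    movesAfter (some (t + o)) (l.map (Jump.shift o)) = movesAfter (some t) l := by
  induction l generalizing t with
  | nil => rfl
  | cons j l ih =>
    rw [List.map_cons, movesAfter, movesAfter, Jump.tgt_shift, ih]
    congr 1
    simp [Jump.shift]

theorem lastLanding_shift (o t : Hole) (l : List Jump) :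
    lastLanding (some (t + o)) (l.map (Jump.shift o)) =
      (lastLanding (some t) l).map (· + o) := by
  induction l generalizing t with
  | nil => rfl
  | cons j l ih => rw [List.map_cons, lastLanding, lastLanding, Jump.tgt_shift, ih]

/-- A jump depends only on, and changes only, its three holes. If these stay inside a translate of
`W`, the computation on the patch decides the play, and all holes outside are untouched. -/
theorem plays_of_runLocal {n : ℕ} (W : List Hole) (o : Hole)
    (hW : ∀ x ∈ W, x + o ∈ triangle n) (l : List Jump) :
    ∀ (S S' : List Hole) (B : Finset Hole), runLocal W S l = some S' →
      (∀ x ∈ W, x + o ∈ B ↔ x ∈ S) →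
      ∃ B', Plays n B (l.map (Jump.shift o)) B' ∧ (∀ x ∈ W, x + o ∈ B' ↔ x ∈ S') ∧
        ∀ y, y - o ∉ W → (y ∈ B' ↔ y ∈ B) := by
  induction l with
  | nil =>
    intro S S' B h hB
    simp only [runLocal, Option.some.injEq] at h
    exact ⟨B, Plays.nil B, h ▸ hB, fun _ _ => Iff.rfl⟩
  | cons j l ih =>
    intro S S' B h hB
    rw [runLocal] at h
    split_ifs at h with hj
    obtain ⟨hd, hs, ho, hoW, hsW, htW, ht⟩ := hj
    obtain ⟨B', h1, h2, h3⟩ := ih _ S' (Jump.result B (j.shift o)) h (by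
      intro x hx
      rw [Jump.result, Jump.tgt_shift, Jump.over_shift, Finset.mem_insert, Finset.mem_erase,
        Finset.mem_erase, hB x hx, List.mem_cons, List.mem_filter]
      simp only [Jump.shift, ne_eq, add_left_inj, decide_eq_true_eq]
      tauto)
    refine ⟨B', Plays.cons ⟨hd, (hB _ hsW).2 hs, ?_, ?_, ?_⟩ h1, h2, ?_⟩
    · rw [Jump.over_shift]; exact (hB _ hoW).2 ho
    · rw [Jump.tgt_shift]; exact hW _ htW
    · rw [Jump.tgt_shift, hB _ htW]; exact ht
    · intro y hy
      rw [h3 y hy, Jump.result, Jump.tgt_shift, Jump.over_shift, Finset.mem_insert,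
        Finset.mem_erase, Finset.mem_erase]
      have key : ∀ z ∈ W, y ≠ z + o := fun z hz e => hy (by rw [e]; simpa using hz)
      simp [key _ htW, key _ hoW, Jump.shift, key _ hsW]

theorem Plays.patch {n : ℕ} {P Q : ℤ → ℤ → Prop} (W S S' : List Hole) (l : List Jump) (a b : ℤ)
    (hrun : runLocal W S l = some S')
    (hW : ∀ x ∈ W, 0 ≤ x.2 + b ∧ x.2 + b ≤ x.1 + a ∧ x.1 + a < n)
    (hS : ∀ x ∈ W, P (x.1 + a) (x.2 + b) ↔ x ∈ S)
    (hQ : ∀ x ∈ W, Q (x.1 + a) (x.2 + b) ↔ x ∈ S')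
    (hout : ∀ r c : ℤ, 0 ≤ c → c ≤ r → r < n → (r - a, c - b) ∉ W → (Q r c ↔ P r c)) :
    Plays n (board n P) (l.map (Jump.shift (a, b))) (board n Q) := by
  obtain ⟨B', h1, h2, h3⟩ := plays_of_runLocal (n := n) W (a, b)
    (fun x hx => mem_triangle.2 (hW x hx)) l S S' (board n P) hrun
    (fun x hx => (mem_board.trans (and_iff_right (hW x hx))).trans (hS x hx))
  have e : B' = board n Q := by
    ext ⟨r, c⟩
    by_cases hx : (r - a, c - b) ∈ W
    · have e1 : ((r, c) : Hole) = (r - a, c - b) + (a, b) := by simp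
      rw [e1, h2 _ hx, ← hQ _ hx]
      exact (mem_board.trans (and_iff_right (hW _ hx))).symm
    · rw [h3 _ hx, mem_board, mem_board]
      exact and_congr_right fun h => (hout r c h.1 h.2.1 h.2.2 hx).symm
  rwa [e] at h1

theorem Reach.patch_aux {n : ℕ} {P Q : ℤ → ℤ → Prop} {p : Option Hole} {k : ℕ} {t : Hole}
    (W S S' : List Hole) (j : Jump) (l : List Jump) (a b : ℤ)
    (hrun : runLocal W S (j :: l) = some S')
    (hk : (if p = some (j.src.1 + a, j.src.2 + b) then 0 else 1) + movesAfter (some j.tgt) l = k)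
    (hlast : lastLanding none (j :: l) = some t)
    (hW : ∀ x ∈ W, 0 ≤ x.2 + b ∧ x.2 + b ≤ x.1 + a ∧ x.1 + a < n)
    (hS : ∀ x ∈ W, P (x.1 + a) (x.2 + b) ↔ x ∈ S)
    (hQ : ∀ x ∈ W, Q (x.1 + a) (x.2 + b) ↔ x ∈ S')
    (hout : ∀ r c : ℤ, 0 ≤ c → c ≤ r → r < n → (r - a, c - b) ∉ W → (Q r c ↔ P r c)) :
    Reach n (board n P) p k (board n Q) (some (t.1 + a, t.2 + b)) := by
  refine ⟨_, Plays.patch W S S' (j :: l) a b hrun hW hS hQ hout, ?_, ?_⟩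
  · rw [List.map_cons, movesAfter, Jump.tgt_shift, movesAfter_shift, ← hk]
    rfl
  · rw [List.map_cons, lastLanding, Jump.tgt_shift, lastLanding_shift]
    rw [lastLanding] at hlast
    rw [hlast]
    rfl

/-- Jumps on a patch can be played on every board that contains a translate of the patch. -/
theorem Reach.patch {n : ℕ} {P Q : ℤ → ℤ → Prop} {p : Option Hole} {k : ℕ} {t : Hole}
    (W S S' : List Hole) (j : Jump) (l : List Jump) (a b : ℤ)
    (hrun : runLocal W S (j :: l) = some S') (hk : numMoves (j :: l) = k)
    (hlast : lastLanding none (j :: l) = some t) (hp : p ≠ some (j.src.1 + a, j.src.2 + b))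
    (hW : ∀ x ∈ W, 0 ≤ x.2 + b ∧ x.2 + b ≤ x.1 + a ∧ x.1 + a < n)
    (hS : ∀ x ∈ W, P (x.1 + a) (x.2 + b) ↔ x ∈ S)
    (hQ : ∀ x ∈ W, Q (x.1 + a) (x.2 + b) ↔ x ∈ S')
    (hout : ∀ r c : ℤ, 0 ≤ c → c ≤ r → r < n → (r - a, c - b) ∉ W → (Q r c ↔ P r c)) :
    Reach n (board n P) p k (board n Q) (some (t.1 + a, t.2 + b)) :=
  Reach.patch_aux W S S' j l a b hrun (by rw [if_neg hp, ← hk, numMoves_cons]) hlast hW hS hQ hout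

/-- Jumps on a patch that continue the move of the last jump. -/
theorem Reach.patch_continue {n : ℕ} {P Q : ℤ → ℤ → Prop} {p : Option Hole} {k : ℕ} {t : Hole}
    (W S S' : List Hole) (j : Jump) (l : List Jump) (a b : ℤ)
    (hrun : runLocal W S (j :: l) = some S') (hk : movesAfter (some j.tgt) l = k)
    (hlast : lastLanding none (j :: l) = some t) (hp : p = some (j.src.1 + a, j.src.2 + b))
    (hW : ∀ x ∈ W, 0 ≤ x.2 + b ∧ x.2 + b ≤ x.1 + a ∧ x.1 + a < n)
    (hS : ∀ x ∈ W, P (x.1 + a) (x.2 + b) ↔ x ∈ S)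
    (hQ : ∀ x ∈ W, Q (x.1 + a) (x.2 + b) ↔ x ∈ S')
    (hout : ∀ r c : ℤ, 0 ≤ c → c ≤ r → r < n → (r - a, c - b) ∉ W → (Q r c ↔ P r c)) :
    Reach n (board n P) p k (board n Q) (some (t.1 + a, t.2 + b)) :=
  Reach.patch_aux W S S' j l a b hrun (by rw [if_pos hp, ← hk, zero_add]) hlast hW hS hQ hout

/-! ### Walking vacancies and sweeping pegs along a line -/

theorem directions_ne {dr dc : ℤ} (hd : (dr, dc) ∈ directions) : ¬ (dr = 0 ∧ dc = 0) := by
  rintro ⟨rfl, rfl⟩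
  revert hd
  decide

theorem neg_mem_directions {dr dc : ℤ} (hd : (dr, dc) ∈ directions) :
    (-dr, -dc) ∈ directions := by
  simp only [directions, Finset.mem_insert, Finset.mem_singleton, Prod.mk.injEq] at hd ⊢
  omega

theorem line_injective {dr dc : ℤ} (h0 : ¬ (dr = 0 ∧ dc = 0)) {r c i j : ℤ}
    (h1 : r + i * dr = r + j * dr) (h2 : c + i * dc = c + j * dc) : i = j := by
  by_contra hij
  have e1 : (i - j) * dr = 0 := by linear_combination h1
  have e2 : (i - j) * dc = 0 := by linear_combination h2
  have h : i - j ≠ 0 := by omega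
  exact h0 ⟨(mul_eq_zero.1 e1).resolve_left h, (mul_eq_zero.1 e2).resolve_left h⟩

/-- The board is convex: a hole between two board holes on a lattice line is on the board. -/
theorem mid_mem {n : ℤ} {dr dc : ℤ} (hd : (dr, dc) ∈ directions) (k : ℕ) {r c : ℤ}
    (h : 0 ≤ c ∧ c ≤ r ∧ r < n) (h' : 0 ≤ c + 2 * (k + 1) * dc ∧
      c + 2 * (k + 1) * dc ≤ r + 2 * (k + 1) * dr ∧ r + 2 * (k + 1) * dr < n) :
    0 ≤ c + 2 * dc ∧ c + 2 * dc ≤ r + 2 * dr ∧ r + 2 * dr < n := by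
  simp only [directions, Finset.mem_insert, Finset.mem_singleton, Prod.mk.injEq] at hd
  rcases hd with ⟨rfl, rfl⟩ | ⟨rfl, rfl⟩ | ⟨rfl, rfl⟩ | ⟨rfl, rfl⟩ | ⟨rfl, rfl⟩ | ⟨rfl, rfl⟩ <;>
    omega

/-- A hole walks `k` double steps in the direction `(dr, dc)` along a line of pegs, capturing
every second peg of the line. -/
theorem Reach.walk {n : ℕ} {Q : ℤ → ℤ → Prop} {dr dc : ℤ} (hd : (dr, dc) ∈ directions)
    (k : ℕ) : ∀ {P : ℤ → ℤ → Prop} {p : Option Hole} {r c : ℤ},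
    p ≠ some (r + 2 * dr, c + 2 * dc) → ¬ P r c → (0 ≤ c ∧ c ≤ r ∧ r < n) →
    (0 ≤ c + 2 * k * dc ∧ c + 2 * k * dc ≤ r + 2 * k * dr ∧ r + 2 * k * dr < n) →
    (∀ i : ℤ, 1 ≤ i → i ≤ 2 * k → P (r + i * dr) (c + i * dc)) →
    (∀ i : ℤ, 0 ≤ i → i ≤ 2 * k →
      (Q (r + i * dr) (c + i * dc) ↔ i % 2 = 0 ∧ i ≠ 2 * k)) →
    (∀ x y : ℤ, 0 ≤ y → y ≤ x → x < n →
      (∀ i : ℤ, 0 ≤ i → i ≤ 2 * k → ¬ (x = r + i * dr ∧ y = c + i * dc)) → (Q x y ↔ P x y)) →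
    Reach n (board n P) p k (board n Q)
      (if k = 0 then p else some (r + (2 * k - 2) * dr, c + (2 * k - 2) * dc)) := by
  have h0 := directions_ne hd
  induction k with
  | zero =>
    intro P p r c _ hP _ _ _ hQ hQ'
    have : board n P = board n Q := board_congr fun x y h1 h2 h3 => by
      by_cases hx : x = r ∧ y = c
      · obtain ⟨rfl, rfl⟩ := hx
        have := hQ 0 le_rfl (by simp)
        simp at this
        tauto
      · refine (hQ' x y h1 h2 h3 fun i hi hi' => ?_).symm
        obtain rfl : i = 0 := by push_cast at hi'; omega
        simpa using hx
    rw [this]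
    exact Reach.refl _ _ _
  | succ k ih =>
    intro P p r c hp hP hrc hend hseg hQ hQ'
    push_cast at hend hseg hQ hQ'
    set P₁ : ℤ → ℤ → Prop := fun x y => (x = r ∧ y = c) ∨
      (P x y ∧ ¬ (x = r + 2 * dr ∧ y = c + 2 * dc) ∧ ¬ (x = r + dr ∧ y = c + dc)) with hP₁
    have mid := mid_mem hd k hrc hend
    have key : ∀ i j : ℤ, r + i * dr = r + j * dr → c + i * dc = c + j * dc → i = j :=
      fun i j => line_injective h0
    -- The peg two places ahead jumps back into the vacancy, which thereby advances two places. The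
    -- next peg to jump stands beyond the new vacancy, away from this landing, so each step is a
    -- move.
    have step : Reach n (board n P) p 1 (board n P₁) (some (r, c)) := by
      have := Reach.jump (n := n) (P := P) (Q := P₁) (p := p) (k := 1) (r + 2 * dr) (c + 2 * dc)
        (-dr) (-dc) (neg_mem_directions hd) (if_neg hp)
        ⟨mid.1, mid.2.1, mid.2.2, hseg 2 (by omega) (by omega)⟩
        (by have := hseg 1 le_rfl (by omega); convert this using 1 <;> ring)
        (by
          have e1 : r + 2 * dr + 2 * -dr = r := by ring
          have e2 : c + 2 * dc + 2 * -dc = c := by ring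
          rw [e1, e2]
          exact ⟨hrc.1, hrc.2.1, hrc.2.2, hP⟩)
        (by
          intro x y _ _ _
          have e1 : r + 2 * dr + 2 * -dr = r := by ring
          have e2 : c + 2 * dc + 2 * -dc = c := by ring
          have e3 : r + 2 * dr + -dr = r + dr := by ring
          have e4 : c + 2 * dc + -dc = c + dc := by ring
          rw [e1, e2, e3, e4])
      convert this using 3 <;> ring
    have rest := ih (P := P₁) (p := some (r, c)) (r := r + 2 * dr) (c := c + 2 * dc) (by
        simp only [ne_eq, Option.some.injEq, Prod.mk.injEq]; omega)
      (by simp only [hP₁]; rintro (h | h) <;> [omega; exact h.2.1 (by simp)]) mid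
      (by
        have e1 : r + 2 * dr + 2 * k * dr = r + 2 * (k + 1) * dr := by ring
        have e2 : c + 2 * dc + 2 * k * dc = c + 2 * (k + 1) * dc := by ring
        rwa [e1, e2])
      (fun i h1 h2 => by
        have := hseg (i + 2) (by omega) (by omega)
        simp only [hP₁]
        refine Or.inr ⟨by convert this using 1 <;> ring, fun h => ?_, fun h => ?_⟩
        · have := key (i + 2) 2 (by linear_combination h.1) (by linear_combination h.2)
          omega
        · have := key (i + 2) 1 (by linear_combination h.1) (by linear_combination h.2)
          omega)
      (fun i h1 h2 => by
        have := hQ (i + 2) (by omega) (by omega)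
        have e1 : r + 2 * dr + i * dr = r + (i + 2) * dr := by ring
        have e2 : c + 2 * dc + i * dc = c + (i + 2) * dc := by ring
        rw [e1, e2, this]
        omega)
      (fun x y h1 h2 h3 hx => by
        by_cases hx0 : x = r ∧ y = c
        · obtain ⟨rfl, rfl⟩ := hx0
          have := hQ 0 le_rfl (by omega)
          simp at this
          simp [hP₁, this]
          omega
        by_cases hx1 : x = r + dr ∧ y = c + dc
        · have := hQ 1 (by omega) (by omega)
          simp at this
          rw [hx1.1, hx1.2]
          simp [hP₁, this]
          omega
        have hx2 : ¬ (x = r + 2 * dr ∧ y = c + 2 * dc) := by simpa using hx 0 le_rfl (by omega)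
        rw [hQ' x y h1 h2 h3 (fun i hi hi' => ?_)]
        · simp only [hP₁]; tauto
        · rcases (show i = 0 ∨ i = 1 ∨ 2 ≤ i by omega) with rfl | rfl | hi2
          · simpa using hx0
          · simpa using hx1
          · have := hx (i - 2) (by omega) (by omega)
            convert this using 3 <;> ring)
    have := step.trans rest
    rw [add_comm 1 k] at this
    convert this using 1
    rw [if_neg (Nat.succ_ne_zero k)]
    split_ifs with hk
    · subst hk; simp
    · congr 2 <;> push_cast <;> ring

/-- A peg that has just landed sweeps along a line, capturing `k` pegs. -/
theorem Reach.sweep {n : ℕ} {Q : ℤ → ℤ → Prop} {dr dc : ℤ} (hd : (dr, dc) ∈ directions)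
    (k : ℕ) : ∀ {P : ℤ → ℤ → Prop} {r c : ℤ}, P r c → (0 ≤ c ∧ c ≤ r ∧ r < n) →
    (0 ≤ c + 2 * k * dc ∧ c + 2 * k * dc ≤ r + 2 * k * dr ∧ r + 2 * k * dr < n) →
    (∀ i : ℤ, 1 ≤ i → i ≤ 2 * k → (P (r + i * dr) (c + i * dc) ↔ i % 2 = 1)) →
    (∀ i : ℤ, 0 ≤ i → i ≤ 2 * k → (Q (r + i * dr) (c + i * dc) ↔ i = 2 * k)) →
    (∀ x y : ℤ, 0 ≤ y → y ≤ x → x < n →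
      (∀ i : ℤ, 0 ≤ i → i ≤ 2 * k → ¬ (x = r + i * dr ∧ y = c + i * dc)) → (Q x y ↔ P x y)) →
    Reach n (board n P) (some (r, c)) 0 (board n Q) (some (r + 2 * k * dr, c + 2 * k * dc)) := by
  have h0 := directions_ne hd
  induction k with
  | zero =>
    intro P r c hP _ _ _ hQ hQ'
    have : board n P = board n Q := board_congr fun x y h1 h2 h3 => by
      by_cases hx : x = r ∧ y = c
      · obtain ⟨rfl, rfl⟩ := hx
        have := hQ 0 le_rfl (by simp)
        simp at this
        tauto
      · refine (hQ' x y h1 h2 h3 fun i hi hi' => ?_).symm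
        obtain rfl : i = 0 := by push_cast at hi'; omega
        simpa using hx
    rw [this]
    simpa using Reach.refl _ _ _
  | succ k ih =>
    intro P r c hP hrc hend hseg hQ hQ'
    push_cast at hend hseg hQ hQ'
    set P₁ : ℤ → ℤ → Prop := fun x y => (x = r + 2 * dr ∧ y = c + 2 * dc) ∨
      (P x y ∧ ¬ (x = r ∧ y = c) ∧ ¬ (x = r + dr ∧ y = c + dc)) with hP₁
    have mid := mid_mem hd k hrc hend
    have key : ∀ i j : ℤ, r + i * dr = r + j * dr → c + i * dc = c + j * dc → i = j :=
      fun i j => line_injective h0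
    have step : Reach n (board n P) (some (r, c)) 0 (board n P₁)
        (some (r + 2 * dr, c + 2 * dc)) :=
      Reach.jump (n := n) (P := P) (Q := P₁) (k := 0) r c dr dc hd (if_pos rfl)
        ⟨hrc.1, hrc.2.1, hrc.2.2, hP⟩ (by simpa using hseg 1 le_rfl (by omega))
        ⟨mid.1, mid.2.1, mid.2.2, by
          have := hseg 2 (by omega) (by omega)
          simpa using this⟩ (fun x y _ _ _ => Iff.rfl)
    have rest := ih (P := P₁) (r := r + 2 * dr) (c := c + 2 * dc) (by simp [hP₁]) mid
      (by
        have e1 : r + 2 * dr + 2 * k * dr = r + 2 * (k + 1) * dr := by ring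
        have e2 : c + 2 * dc + 2 * k * dc = c + 2 * (k + 1) * dc := by ring
        rwa [e1, e2])
      (fun i h1 h2 => by
        have := hseg (i + 2) (by omega) (by omega)
        have e1 : r + 2 * dr + i * dr = r + (i + 2) * dr := by ring
        have e2 : c + 2 * dc + i * dc = c + (i + 2) * dc := by ring
        have n2 : ¬ (r + (i + 2) * dr = r + 2 * dr ∧ c + (i + 2) * dc = c + 2 * dc) := fun h => by
          have := key _ _ h.1 h.2
          omega
        have n0 : ¬ (r + (i + 2) * dr = r ∧ c + (i + 2) * dc = c) := fun h => by
          have := key (i + 2) 0 (by linear_combination h.1) (by linear_combination h.2)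
          omega
        have n1 : ¬ (r + (i + 2) * dr = r + dr ∧ c + (i + 2) * dc = c + dc) := fun h => by
          have := key (i + 2) 1 (by linear_combination h.1) (by linear_combination h.2)
          omega
        rw [e1, e2]
        simp only [hP₁, n2, n0, n1, false_or, not_false_eq_true, and_true, this]
        omega)
      (fun i h1 h2 => by
        have := hQ (i + 2) (by omega) (by omega)
        have e1 : r + 2 * dr + i * dr = r + (i + 2) * dr := by ring
        have e2 : c + 2 * dc + i * dc = c + (i + 2) * dc := by ring
        rw [e1, e2, this]
        omega)
      (fun x y h1 h2 h3 hx => by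
        have hx2 : ¬ (x = r + 2 * dr ∧ y = c + 2 * dc) := by simpa using hx 0 le_rfl (by omega)
        by_cases hx0 : x = r ∧ y = c
        · obtain ⟨rfl, rfl⟩ := hx0
          have := hQ 0 le_rfl (by omega)
          simp only [zero_mul, add_zero] at this
          simp only [hP₁, this, hx2]
          simp
          omega
        by_cases hx1 : x = r + dr ∧ y = c + dc
        · have := hQ 1 (by omega) (by omega)
          simp only [one_mul] at this
          rw [hx1.1, hx1.2] at hx2 ⊢
          simp only [hP₁, this, hx2]
          simp
          omega
        rw [hQ' x y h1 h2 h3 (fun i hi hi' => ?_)]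
        · simp only [hP₁]; tauto
        · rcases (show i = 0 ∨ i = 1 ∨ 2 ≤ i by omega) with rfl | rfl | hi2
          · simpa using hx0
          · simpa using hx1
          · have := hx (i - 2) (by omega) (by omega)
            convert this using 3 <;> ring)
    have := step.trans rest
    convert this using 3 <;> push_cast <;> ring

end PegSolitaire

/-! ### The scheme on side `2m`: opening and vacancy walks -/

namespace PegSolitaire

theorem Reach.cast {n : ℕ} {B B' : Finset Hole} {p q q' : Option Hole} {k k' : ℕ}
    (h : Reach n B p k B' q) (hk : k = k') (hq : q = q') : Reach n B p k' B' q' := by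
  rwa [hk, hq] at h

/-- The position after the opening in the right corner of `Triangle(2m)`. -/
def afterOpening (m r c : ℤ) : Prop :=
  ¬ (r = 2 * m - 1 ∧ (c = 2 * m - 1 ∨ c = 2 * m - 4)) ∧
  ¬ (r = 2 * m - 2 ∧ (c = 2 * m - 2 ∨ c = 2 * m - 3 ∨ c = 2 * m - 4)) ∧
  ¬ (r = 2 * m - 3 ∧ (c = 2 * m - 3 ∨ c = 2 * m - 4)) ∧
  ¬ (r = 2 * m - 4 ∧ c = 2 * m - 4) ∧ ¬ (r = 2 * m - 5 ∧ c = 2 * m - 5)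

/-- The opening provides the vacancy `(2m - 5, 2m - 5)`, from which the walk up the right side
starts, and the peg `(2m - 1, 2m - 2)`, which later runs along the bottom row. The patch is written
in the coordinates of `Triangle(10)`. -/
theorem reach_afterOpening {n : ℕ} {m : ℤ} (hn : (n : ℤ) = 2 * m) (hm : 6 ≤ m) :
    Reach n (board n fun r c => ¬ (r = 2 * m - 1 ∧ c = 2 * m - 3)) none 5
      (board n (afterOpening m)) (some (2 * m - 1, 2 * m - 3)) := by
  have := Reach.patch (n := n) (P := fun r c => ¬ (r = 2 * m - 1 ∧ c = 2 * m - 3))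
    (Q := afterOpening m) (p := none) (k := 5) (t := (9, 7))
    [(5, 5), (6, 6), (7, 6), (7, 7), (8, 6), (8, 7), (8, 8), (9, 6), (9, 7), (9, 8), (9, 9)]
    [(5, 5), (6, 6), (7, 6), (7, 7), (8, 6), (8, 7), (8, 8), (9, 6), (9, 8), (9, 9)]
    [(9, 7), (9, 8)]
    ⟨(9, 9), (0, -1)⟩ [⟨(9, 6), (0, 1)⟩, ⟨(7, 7), (1, 1)⟩, ⟨(9, 9), (0, -1)⟩, ⟨(7, 6), (1, 0)⟩,
      ⟨(9, 6), (0, 1)⟩, ⟨(5, 5), (1, 1)⟩, ⟨(7, 7), (1, 0)⟩] (2 * m - 10) (2 * m - 10)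
    (by decide) (by decide) (by decide) (by simp)
    (by simp only [List.forall_mem_cons]; simp; omega)
    (by simp only [List.forall_mem_cons]; simp; omega)
    (by simp only [List.forall_mem_cons, afterOpening]; simp; omega) ?_
  · exact this.cast rfl
      (some_hole_congr (by omega) (by omega))
  · intro r c _ _ _ h
    simp only [List.mem_cons, Prod.mk.injEq, List.not_mem_nil, or_false] at h
    unfold afterOpening
    grind

/-- The position after the hole walk up the right side. -/
def afterDiagonal (m r c : ℤ) : Prop :=
  if r = c ∧ 1 ≤ r ∧ r ≤ 2 * m - 5 then r % 2 = 1 ∧ r ≠ 1 else afterOpening m r c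

theorem reach_afterDiagonal {n : ℕ} {m : ℤ} (hn : (n : ℤ) = 2 * m) (hm : 6 ≤ m) {K : ℕ}
    (hK : (K : ℤ) = m - 3) :
    Reach n (board n (afterOpening m)) (some (2 * m - 1, 2 * m - 3)) K
      (board n (afterDiagonal m)) (some (3, 3)) := by
  have := Reach.walk (n := n) (P := afterOpening m) (Q := afterDiagonal m) (dr := -1) (dc := -1)
    (p := some (2 * m - 1, 2 * m - 3)) (r := 2 * m - 5) (c := 2 * m - 5) (by decide) K
    (by simp; omega) (by unfold afterOpening; omega) (by omega) (by omega)
    (by intros; unfold afterOpening; omega)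
    (by intro i h1 h2; unfold afterDiagonal; rw [if_pos (by omega)]; omega)
    (by
      intro x y _ _ _ h
      have := h (2 * m - 5 - x)
      unfold afterDiagonal
      rw [if_neg (by omega)])
  refine this.cast rfl ?_
  rw [if_neg (by omega)]
  exact some_hole_congr (by omega) (by omega)

/-- The position after the first `t` groups of three columns have received their holes. -/
def afterGroups (m t r c : ℤ) : Prop :=
  afterDiagonal m r c ∧ ¬ (c = r - 1 ∧ 3 ≤ r ∧ r < 2 + 6 * t ∧ r % 6 ≠ 2) ∧
    ¬ (r % 6 = 5 ∧ r < 2 + 6 * t ∧ (c = r ∨ c = r - 2))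

theorem afterDiagonal_iff {m r c : ℤ} (h : r ≤ 2 * m - 4) (hm : 3 ≤ m) :
    afterDiagonal m r c ↔ ¬ (r = c ∧ 1 ≤ r) ∨ (r % 2 = 1 ∧ r ≠ 1) := by
  unfold afterDiagonal afterOpening
  split_ifs <;> omega

/-- Four moves with seven captures open the vacancies `(6t+3, 6t+2)`, `(6t+5, 6t+4)` and `(6t+7,
6t+6)`, the starting points of the walks down three even columns. The helper peg `(6t+8, 6t+6)`
returns to its hole. -/
theorem reach_afterGroups_succ {n : ℕ} {m : ℤ} (hn : (n : ℤ) = 2 * m) {t : ℤ} (ht : 0 ≤ t)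
    (htm : 3 * t + 6 ≤ m) {p : Option Hole} (hp : p ≠ some (6 * t + 8, 6 * t + 6)) :
    Reach n (board n (afterGroups m t)) p 4 (board n (afterGroups m (t + 1)))
      (some (6 * t + 8, 6 * t + 6)) := by
  have := Reach.patch (n := n) (P := afterGroups m t)
    (Q := afterGroups m (t + 1)) (p := p) (k := 4) (t := (6, 4))
    [(1, 0), (2, 1), (2, 2), (3, 1), (3, 2), (3, 3), (4, 3), (4, 4), (5, 4), (6, 4)]
    [(1, 0), (2, 1), (3, 1), (3, 2), (3, 3), (4, 3), (5, 4), (6, 4)]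
    [(6, 4)]
    ⟨(6, 4), (-1, 0)⟩ [⟨(4, 4), (-1, -1)⟩, ⟨(3, 1), (0, 1)⟩, ⟨(1, 0), (1, 1)⟩, ⟨(3, 2), (1, 1)⟩,
      ⟨(2, 2), (1, 1)⟩, ⟨(4, 4), (1, 0)⟩] (6 * t + 2) (6 * t + 2)
    (by decide) (by decide) (by decide) (fun h => hp (h.trans (by simp only [Option.some.injEq, Prod.mk.injEq]; omega)))
    (by simp only [List.forall_mem_cons]; simp; omega)
    ?_ ?_ ?_
  · exact this.cast rfl
      (some_hole_congr (by omega) (by omega))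
  · simp only [List.forall_mem_cons]
    simp [afterGroups]
    grind [afterDiagonal_iff]
  · simp only [List.forall_mem_cons]
    simp [afterGroups]
    grind [afterDiagonal_iff]
  · intro r c _ _ _ h
    simp only [List.mem_cons, Prod.mk.injEq, List.not_mem_nil, or_false] at h
    unfold afterGroups
    grind (splits := 40)

theorem reach_afterGroups {n : ℕ} {m : ℤ} (hn : (n : ℤ) = 2 * m) {K : ℕ} (hK : 1 ≤ K)
    (hm : m = 3 * K + 3) :
    Reach n (board n (afterDiagonal m)) (some (3, 3)) (K * 4) (board n (afterGroups m K))
      (some (6 * K + 2, 6 * K)) := by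
  have := Reach.iterate (n := n) (fun t => board n (afterGroups m t))
    (fun t => if t = 0 then some (3, 3) else some (6 * t + 2, 6 * t)) 4 K (by
    intro t ht
    have := reach_afterGroups_succ hn (t := t) (by omega) (by omega)
      (p := if t = 0 then some (3, 3) else some (6 * t + 2, 6 * t))
      (by split_ifs <;> (simp; try omega))
    rw [if_neg (show ¬ t + 1 = 0 by omega)]
    push_cast
    exact this.cast rfl
      (some_hole_congr (by omega) (by omega)))
  rw [if_neg (show ¬ K = 0 by omega), if_pos rfl] at this
  rwa [board_congr (P := afterGroups m (0 : ℕ)) (Q := afterDiagonal m)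
    (by intros; exact and_iff_left (by push_cast; omega))] at this

/-- The position after the holes of the columns `1, …, j` have walked down. -/
def afterColumns (m j r c : ℤ) : Prop :=
  if c % 2 = 0 ∧ 2 ≤ c ∧ c ≤ 2 * j ∧ c + 1 ≤ r then r % 2 = 1 ∧ r ≠ 2 * m - 1
  else afterGroups m (m / 3 - 1) r c

/-- The vacancy ends in the bottom row, so besides the even rows of the column this also opens a
landing place for the peg that will run along the bottom row. -/
theorem reach_afterColumns_succ {n : ℕ} {m j : ℤ} (hn : (n : ℤ) = 2 * m)
    (hm3 : m % 3 = 0) (hj : 0 ≤ j) (hjm : j + 1 ≤ m - 3) {k : ℕ} (hk : (k : ℤ) = m - 2 - j)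
    {p : Option Hole} (hp : p ≠ some (2 * j + 5, 2 * j + 2)) :
    Reach n (board n (afterColumns m j)) p k (board n (afterColumns m (j + 1)))
      (some (2 * m - 3, 2 * j + 2)) := by
  have := Reach.walk (n := n) (P := afterColumns m j) (Q := afterColumns m (j + 1)) (dr := 1)
    (dc := 0) (p := p) (r := 2 * j + 3) (c := 2 * j + 2) (by decide) k
    (fun h => hp (h.trans (by simp only [Option.some.injEq, Prod.mk.injEq]; omega)))
    ?_ (by omega) (by omega) ?_ ?_ ?_
  · refine this.cast rfl ?_
    rw [if_neg (by omega)]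
    exact some_hole_congr (by omega) (by omega)
  · unfold afterColumns
    rw [if_neg (by omega)]
    unfold afterGroups
    omega
  · intro i h1 h2
    unfold afterColumns
    rw [if_neg (by omega)]
    unfold afterGroups afterDiagonal
    rw [if_neg (by omega)]
    unfold afterOpening
    omega
  · intro i h1 h2
    unfold afterColumns
    rw [if_pos (by omega)]
    omega
  · intro x y _ _ _ h
    have := h (x - (2 * j + 3))
    unfold afterColumns
    split_ifs <;> first | rfl | omega

end PegSolitaire

namespace PegSolitaire

/-- The walks take `m - 2`, `m - 3`, … moves; the sum of this arithmetic series is stated doubled.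
-/
theorem reach_afterColumns {n : ℕ} {m : ℤ} (hn : (n : ℤ) = 2 * m)
    (hm3 : m % 3 = 0) (J : ℕ) (hJ : (J : ℤ) ≤ m - 3) :
    ∃ K : ℕ, 2 * (K : ℤ) = J * (2 * m - 3 - J) ∧
      Reach n (board n (afterGroups m (m / 3 - 1))) (some (2 * m - 4, 2 * m - 6)) K
        (board n (afterColumns m J))
        (if J = 0 then some (2 * m - 4, 2 * m - 6) else some (2 * m - 3, 2 * J)) := by
  induction J with
  | zero =>
    refine ⟨0, by simp, ?_⟩
    have : board n (afterGroups m (m / 3 - 1)) = board n (afterColumns m (0 : ℕ)) :=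
      board_congr fun r c _ _ _ => by
        unfold afterColumns
        rw [if_neg (by push_cast; omega)]
    rw [this, if_pos rfl]
    exact Reach.refl _ _ _
  | succ J ih =>
    push_cast at hJ
    obtain ⟨K, hK, h⟩ := ih (by omega)
    obtain ⟨k, hk⟩ : ∃ k : ℕ, (k : ℤ) = m - 2 - J := ⟨(m - 2 - J).toNat, by omega⟩
    have := reach_afterColumns_succ hn hm3 (j := J) (by omega) (by omega) hk
      (p := if J = 0 then some (2 * m - 4, 2 * m - 6) else some (2 * m - 3, 2 * J))
      (by split_ifs <;> simp only [ne_eq, Option.some.injEq, Prod.mk.injEq] <;> omega)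
    refine ⟨K + k, ?_, ?_⟩
    · push_cast
      linear_combination hK + 2 * hk
    · rw [if_neg (show ¬ J + 1 = 0 by omega)]
      push_cast
      exact (h.trans this).cast rfl
        (some_hole_congr (by omega) (by omega))

/-- The position after the jumps in the top corner. -/
def afterTop (m r c : ℤ) : Prop :=
  (r = 1 ∧ c = 1) ∨ (afterColumns m (m - 3) r c ∧ ¬ (r = 0 ∧ c = 0) ∧ ¬ (r = 1 ∧ c = 0) ∧
    ¬ (r = 2 ∧ c = 1) ∧ ¬ (r = 3 ∧ c = 1) ∧ ¬ (r = 3 ∧ c = 2))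

/-- This opens the vacancy `(1, 0)` for the walk down column `0` and leaves pegs in `(1, 1)` and
`(3, 3)`, over which the final sweep turns at the top. -/
theorem reach_afterTop {n : ℕ} {m : ℤ} (hn : (n : ℤ) = 2 * m) (hm : 6 ≤ m)
    {p : Option Hole} (hp : p ≠ some (2, 0)) :
    Reach n (board n (afterColumns m (m - 3))) p 4 (board n (afterTop m)) (some (3, 3)) := by
  refine Reach.patch (n := n) (P := afterColumns m (m - 3)) (Q := afterTop m) (p := p) (k := 4)
    (t := (3, 3))
    [(0, 0), (1, 0), (2, 0), (2, 1), (2, 2), (1, 1), (3, 1), (3, 2), (3, 3)]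
    [(0, 0), (1, 0), (2, 0), (2, 1), (3, 1), (3, 2), (3, 3)]
    [(3, 3), (1, 1), (2, 0)]
    ⟨(2, 0), (0, 1)⟩ [⟨(0, 0), (1, 0)⟩, ⟨(3, 3), (-1, -1)⟩, ⟨(3, 1), (0, 1)⟩] 0 0
    (by decide) (by decide) (by decide) hp
    (by simp only [List.forall_mem_cons]; simp; omega) ?_ ?_ ?_
  · simp only [List.forall_mem_cons]
    simp [afterColumns, afterGroups]
    grind [afterDiagonal_iff]
  · simp only [List.forall_mem_cons]
    simp [afterTop, afterColumns, afterGroups]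
    grind [afterDiagonal_iff]
  · intro r c _ _ _ h
    simp only [List.mem_cons, Prod.mk.injEq, List.not_mem_nil, or_false] at h
    unfold afterTop
    grind

/-- The position after the hole of column `0` has made `i` steps and the peg of the bottom row
has made `u` jumps. -/
def afterHops (m i u r c : ℤ) : Prop :=
  if c = 0 ∧ r ≤ 2 * i + 1 then r % 2 = 1 ∧ r ≠ 2 * i + 1
  else if r = 2 * m - 1 ∧ 2 * m - 2 - 2 * u ≤ c then c = 2 * m - 2 - 2 * u
  else afterTop m r c

theorem afterHops_left {m i u r : ℤ} (hi : 0 ≤ i) (hr : 2 * i + 2 ≤ r) (hr' : r ≤ 2 * m - 3)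
    (hm : 6 ≤ m) : afterHops m i u r 0 := by
  unfold afterHops afterTop afterColumns afterGroups afterDiagonal afterOpening
  rw [if_neg (by omega), if_neg (by omega), if_neg (by omega), if_neg (by omega)]
  omega

theorem afterTop_bottom {m c : ℤ} (hm : 6 ≤ m) (hm3 : m % 3 = 0) (hc : 0 ≤ c) :
    afterTop m (2 * m - 1) c ↔
      c ≠ 2 * m - 1 ∧ c ≠ 2 * m - 4 ∧ ¬ (c % 2 = 0 ∧ 2 ≤ c ∧ c ≤ 2 * m - 6) := by
  have h1 : afterDiagonal m (2 * m - 1) c ↔ c ≠ 2 * m - 1 ∧ c ≠ 2 * m - 4 := by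
    unfold afterDiagonal afterOpening
    rw [if_neg (by omega)]
    omega
  have h2 : afterGroups m (m / 3 - 1) (2 * m - 1) c ↔ c ≠ 2 * m - 1 ∧ c ≠ 2 * m - 4 := by
    unfold afterGroups
    rw [h1]
    omega
  unfold afterTop afterColumns
  rw [h2]
  split_ifs <;> omega

theorem afterHops_bottom {m i u c : ℤ} (hm : 6 ≤ m) (hm3 : m % 3 = 0)
    (hc : 1 ≤ c) (hc' : c < 2 * m - 2 - 2 * u) (hu : 0 ≤ u) :
    afterHops m i u (2 * m - 1) c ↔ c % 2 = 1 := by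
  unfold afterHops
  rw [if_neg (by omega), if_neg (by omega), afterTop_bottom hm hm3 (by omega)]
  omega

theorem reach_afterHops_left {n : ℕ} {m i u : ℤ} (hn : (n : ℤ) = 2 * m) (hm : 6 ≤ m)
    (hi : 0 ≤ i) (him : i ≤ m - 3) {p : Option Hole} (hp : p ≠ some (2 * i + 3, 0)) :
    Reach n (board n (afterHops m i u)) p 1 (board n (afterHops m (i + 1) u))
      (some (2 * i + 1, 0)) := by
  refine (Reach.jump (n := n) (p := p) (k := 1) (2 * i + 3) 0 (-1) 0 (by decide)
    (if_neg hp) ⟨by omega, by omega, by omega, afterHops_left hi (by omega) (by omega) hm⟩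
    (afterHops_left hi (by omega) (by omega) hm) ⟨by omega, by omega, by omega, ?_⟩ ?_).cast rfl ?_
  · unfold afterHops
    rw [if_pos (by omega)]
    omega
  · intro x y _ _ _
    unfold afterHops
    split_ifs <;> first | omega | skip
    rw [or_iff_right (by omega)]
    exact (and_iff_left (by omega)).symm
  · simp only [Option.some.injEq, Prod.mk.injEq]
    omega

theorem reach_afterHops_bottom {n : ℕ} {m i u : ℤ} (hn : (n : ℤ) = 2 * m) (hm : 6 ≤ m)
    (hm3 : m % 3 = 0) (hi : i ≤ m - 2) (hu : 0 ≤ u) (hum : u ≤ m - 3) {p : Option Hole} {k : ℕ}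
    (hp : (if p = some (2 * m - 1, 2 * m - 2 - 2 * u) then 0 else 1) = k) :
    Reach n (board n (afterHops m i u)) p k (board n (afterHops m i (u + 1)))
      (some (2 * m - 1, 2 * m - 2 - 2 * (u + 1))) := by
  refine (Reach.jump (n := n) (p := p) (k := k) (2 * m - 1) (2 * m - 2 - 2 * u) 0 (-1) (by decide)
    hp ⟨by omega, by omega, by omega, ?_⟩ ?_ ⟨by omega, by omega, by omega, ?_⟩ ?_).cast rfl ?_
  · unfold afterHops
    rw [if_neg (by omega), if_pos (by omega)]
  · rw [add_zero, afterHops_bottom hm hm3 (by omega) (by omega) hu]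
    omega
  · rw [mul_zero, add_zero, afterHops_bottom hm hm3 (by omega) (by omega) hu]
    omega
  · intro x y _ _ _
    unfold afterHops
    split_ifs <;> first | omega | skip
    rw [or_iff_right (by omega)]
    exact (and_iff_left (by omega)).symm
  · simp only [Option.some.injEq, Prod.mk.injEq]
    omega

/-- The walk down column `0` takes `m - 2` moves, and the run of the bottom-row peg is one move if
uninterrupted. Alternating the two for `s` rounds breaks the run `s` times, and each break costs one
more move. This freedom serves to hit a prescribed length. -/
theorem reach_afterHops {n : ℕ} {m : ℤ} (hn : (n : ℤ) = 2 * m) (hm : 6 ≤ m)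
    (hm3 : m % 3 = 0) (s k : ℕ) (hs : (s : ℤ) ≤ m - 4) (hk : (k : ℤ) = m - 1 + s) :
    Reach n (board n (afterTop m)) (some (3, 3)) k (board n (afterHops m (m - 2) (m - 2)))
      (some (2 * m - 1, 2)) := by
  have h0 : board n (afterTop m) = board n (afterHops m (0 : ℕ) (0 : ℕ)) :=
    board_congr fun r c _ _ _ => by
      push_cast
      unfold afterHops
      split_ifs with h1 h2
      · unfold afterTop
        omega
      · obtain ⟨rfl, h2⟩ := h2
        rw [afterTop_bottom hm hm3 (by omega)]
        omega
      · rfl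
  have h1 := Reach.iterate (n := n) (fun i => board n (afterHops m i i))
    (fun i => if i = 0 then some (3, 3) else some (2 * m - 1, 2 * m - 2 - 2 * i)) 2 s (by
    intro i hi
    have a := reach_afterHops_left (u := i) hn hm (i := i) (by omega) (by omega)
      (p := if i = 0 then some (3, 3) else some (2 * m - 1, 2 * m - 2 - 2 * i))
      (by split_ifs <;> simp only [ne_eq, Option.some.injEq, Prod.mk.injEq] <;> omega)
    have b := reach_afterHops_bottom (i := i + 1) (u := i) hn hm hm3 (by omega) (by omega) (by omega)
      (p := some (2 * i + 1, 0)) (if_neg (by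
        simp only [Option.some.injEq, Prod.mk.injEq]; omega))
    rw [if_neg (show ¬ i + 1 = 0 by omega)]
    push_cast
    exact a.trans b)
  obtain ⟨K, hK⟩ : ∃ K : ℕ, (K : ℤ) = m - 2 - s := ⟨(m - 2 - s).toNat, by omega⟩
  obtain ⟨L, hL⟩ : ∃ L : ℕ, (L : ℤ) = m - 3 - s := ⟨(m - 3 - s).toNat, by omega⟩
  have h2 := Reach.iterate (n := n) (fun i => board n (afterHops m (s + i) s))
    (fun i => if i = 0 then
      (if s = 0 then some (3, 3) else some (2 * m - 1, 2 * m - 2 - 2 * s))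
      else some (2 * (s + i) - 1, 0)) 1 K (by
    intro i hi
    have a := reach_afterHops_left (u := s) hn hm (i := s + i) (by omega) (by omega)
      (p := if i = 0 then (if s = 0 then some (3, 3) else some (2 * m - 1, 2 * m - 2 - 2 * s))
        else some (2 * (s + i) - 1, 0))
      (by split_ifs <;> simp only [ne_eq, Option.some.injEq, Prod.mk.injEq] <;> omega)
    rw [if_neg (show ¬ i + 1 = 0 by omega)]
    push_cast
    rw [← add_assoc]
    exact a.cast rfl
      (some_hole_congr (by omega) (by omega)))
  have h3 := reach_afterHops_bottom (i := m - 2) (u := s) hn hm hm3 (by omega) (by omega) (by omega)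
    (p := some (2 * (s + K) - 1, 0)) (if_neg (by
      simp only [Option.some.injEq, Prod.mk.injEq]; omega))
  have h4 := Reach.iterate (n := n) (fun u => board n (afterHops m (m - 2) (s + 1 + u)))
    (fun u => some (2 * m - 1, 2 * m - 2 - 2 * (s + 1 + u))) 0 L (by
    intro u hu
    have b := reach_afterHops_bottom (i := m - 2) (u := s + 1 + u) hn hm hm3 (by omega) (by omega)
      (by omega) (if_pos rfl)
    push_cast
    rw [← add_assoc]
    exact b)
  rw [if_pos rfl, ← h0] at h1
  rw [if_pos rfl, if_neg (show ¬ K = 0 by omega), show (s : ℤ) + K = m - 2 by omega] at h2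
  rw [show (s : ℤ) + K = m - 2 by omega] at h3
  rw [show (s : ℤ) + 1 + L = m - 2 by omega] at h4
  simp only [Nat.cast_zero, add_zero] at h2 h4
  exact (((h1.trans h2).trans h3).trans h4).cast (by omega)
    (some_hole_congr (by omega) (by omega))

end PegSolitaire

/-! ### The scheme on side `2m`: the final sweep -/

namespace PegSolitaire

/-- The pegs near the right side that are left over when the vertices of even coordinates have
been removed. -/
def band (m r c : ℤ) : Prop :=
  r - c ≤ 2 ∧ ((r % 6 = 1 ∨ (r % 6 = 2 ∧ c = r - 1 ∧ r ≠ 2) ∨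
    (r % 6 = 3 ∧ (r = 3 → c = 3) ∧ (r = 2 * m - 3 → c = r - 2)) ∨ (r % 6 = 5 ∧ c = r - 1)))

/-- The position before the final sweep. -/
def beforeSweep (m r c : ℤ) : Prop :=
  (r = 2 * m - 2 ∧ c = 0) ∨ (r = 2 * m - 1 ∧ (c = 0 ∨ c = 1)) ∨
    (r ≤ 2 * m - 2 ∧ ¬ (r % 2 = 0 ∧ c % 2 = 0) ∧
      ((3 ≤ r - c ∧ ¬ (r = 2 * m - 2 ∧ c = 1)) ∨ band m r c))

theorem afterGroups_upper {m r c : ℤ} (hm : 6 ≤ m) (hm3 : m % 3 = 0) (h0 : 0 ≤ c) (hc : c ≤ r)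
    (hr : r ≤ 2 * m - 4) : afterGroups m (m / 3 - 1) r c ↔
      (r - c ≥ 3 ∨ (r - c = 2 ∧ (r % 6 ≠ 5)) ∨ 
       (r - c = 1 ∧ (r % 6 = 2 ∨ r < 3 ∨ r = 2 * m - 4)) ∨
       (r = c ∧ (r = 0 ∨ (r % 2 = 1 ∧ r ≠ 1 ∧ (r % 6 ≠ 5))))) := by
  unfold afterGroups
  rw [afterDiagonal_iff hr (by omega)]
  omega

theorem afterColumns_upper {m r c : ℤ} (hm : 6 ≤ m) (hm3 : m % 3 = 0) (h0 : 0 ≤ c) (hc : c ≤ r)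
    (hr : r ≤ 2 * m - 4) : afterColumns m (m - 3) r c ↔ (c = 0 ∧ r % 2 = 0) ∨
      (¬ (r % 2 = 0 ∧ c % 2 = 0) ∧ ¬ (r = 1 ∧ c = 1) ∧
        (3 ≤ r - c ∨ band m r c ∨ r = 2 ∨ r = 3)) := by
  unfold afterColumns
  rw [afterGroups_upper hm hm3 h0 hc hr]
  unfold band
  split_ifs <;> omega

theorem afterColumns_lower {m r c : ℤ} (hm : 6 ≤ m) (hm3 : m % 3 = 0) (h0 : 0 ≤ c) (hc : c ≤ r)
    (hr : r = 2 * m - 3 ∨ r = 2 * m - 2) : afterColumns m (m - 3) r c ↔ (c = 0 ∧ r % 2 = 0) ∨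
      (¬ (r % 2 = 0 ∧ c % 2 = 0) ∧ (3 ≤ r - c ∨ band m r c)) := by
  have h : afterGroups m (m / 3 - 1) r c ↔ afterOpening m r c := by
    unfold afterGroups afterDiagonal
    rw [if_neg (by omega)]
    exact and_iff_left (by omega)
  unfold afterColumns
  rw [h]
  unfold band afterOpening
  rcases hr with rfl | rfl <;> split_ifs <;> omega

/-- Collapses the nested stages into the form used by the sweep. Above the bottom row, the only peg
left on a hole with even coordinates is `(2m - 2, 0)`, the future sweeper. -/
theorem afterHops_iff {m r c : ℤ} (hm : 6 ≤ m) (hm3 : m % 3 = 0) (h0 : 0 ≤ c) (hc : c ≤ r)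
    (hr : r ≤ 2 * m - 2) : afterHops m (m - 2) (m - 2) r c ↔ (r = 2 * m - 2 ∧ c = 0) ∨
      (¬ (r = 2 * m - 3 ∧ c = 0) ∧ ¬ (r % 2 = 0 ∧ c % 2 = 0) ∧ (3 ≤ r - c ∨ band m r c)) := by
  unfold afterHops afterTop
  rcases (show r ≤ 2 * m - 4 ∨ r = 2 * m - 3 ∨ r = 2 * m - 2 by omega) with h | h
  · rw [afterColumns_upper hm hm3 h0 hc h]
    unfold band
    split_ifs
    · omega
    · omega
    · grind
  · rw [afterColumns_lower hm hm3 h0 hc h]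
    have h1 : c = 0 → ¬ band m r c := by unfold band; omega
    split_ifs
    · omega
    · omega
    · grind

/-- The bottom-row peg continues its move into the vacancy left at the foot of column `0`, where it
becomes the first peg the sweeper captures. -/
theorem reach_beforeSweep {n : ℕ} {m : ℤ} (hn : (n : ℤ) = 2 * m) (hm : 6 ≤ m)
    (hm3 : m % 3 = 0) :
    Reach n (board n (afterHops m (m - 2) (m - 2))) (some (2 * m - 1, 2)) 0
      (board n (beforeSweep m)) (some (2 * m - 3, 0)) := by
  have low : ∀ c, 0 ≤ c → (afterHops m (m - 2) (m - 2) (2 * m - 1) c ↔ c ≤ 2) := by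
    intro c h0
    unfold afterHops
    rw [afterTop_bottom hm hm3 h0]
    split_ifs <;> omega
  refine (Reach.jump (n := n) (p := some (2 * m - 1, 2)) (k := 0) (2 * m - 1) 2 (-1) (-1)
    (by decide) (if_pos rfl) ⟨by omega, by omega, by omega, (low _ (by omega)).2 le_rfl⟩ ?_
    ⟨by omega, by omega, by omega, ?_⟩ ?_).cast rfl (some_hole_congr (by omega) (by omega))
  · rw [afterHops_iff hm hm3 (by omega) (by omega) (by omega)]
    omega
  · rw [afterHops_iff hm hm3 (by omega) (by omega) (by omega)]
    omega
  · intro x y h0 hy hx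
    unfold beforeSweep
    rcases (show x = 2 * m - 1 ∨ x ≤ 2 * m - 2 by omega) with rfl | h
    · rw [low y h0]
      omega
    · rw [afterHops_iff hm hm3 h0 hy h]
      unfold band
      omega

/-- The position in which the sweeping peg is in the hole `(x, y)`, besides two pegs of the left
corner and the pegs at which `E` holds. -/
def sweeping (m x y : ℤ) (E : ℤ → ℤ → Prop) (r c : ℤ) : Prop :=
  (r = x ∧ c = y) ∨ (r = 2 * m - 1 ∧ (c = 0 ∨ c = 1)) ∨
    (r ≤ 2 * m - 2 ∧ ¬ (r % 2 = 0 ∧ c % 2 = 0) ∧ E r c)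

/-- The pegs left over when the final sweep has come down to row `R` along the right side. -/
def bandFrom (m R r c : ℤ) : Prop :=
  1 ≤ c ∧ ¬ (r = 2 * m - 2 ∧ c = 1) ∧ (3 ≤ r - c ∨ (R < r ∧ band m r c))

theorem reach_column {n : ℕ} {m : ℤ} (hn : (n : ℤ) = 2 * m) (hm : 6 ≤ m) :
    Reach n (board n (beforeSweep m)) (some (2 * m - 3, 0)) 1
      (board n (sweeping m 2 0 fun r c => (c = 0 → r < 2) ∧ ¬ (r = 2 * m - 2 ∧ c = 1) ∧
        (3 ≤ r - c ∨ band m r c))) (some (2, 0)) := by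
  obtain ⟨k, hk⟩ : ∃ k : ℕ, (k : ℤ) = m - 3 := ⟨(m - 3).toNat, by omega⟩
  have h1 := Reach.jump (n := n) (P := beforeSweep m) (Q := sweeping m (2 * m - 4) 0 fun r c =>
    (c = 0 → r < 2 * m - 4) ∧ ¬ (r = 2 * m - 2 ∧ c = 1) ∧
        (3 ≤ r - c ∨ band m r c)) (p := some (2 * m - 3, 0)) (k := 1) (2 * m - 2) 0 (-1) 0
    (by decide) (if_neg (by simp only [Option.some.injEq, Prod.mk.injEq]; omega))
    (by unfold beforeSweep; omega) (by unfold beforeSweep; omega)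
    (by unfold beforeSweep band; omega) (by unfold beforeSweep sweeping band; grind)
  have h2 := Reach.sweep (n := n) (P := sweeping m (2 * m - 4) 0 fun r c =>
      (c = 0 → r < 2 * m - 4) ∧ ¬ (r = 2 * m - 2 ∧ c = 1) ∧ (3 ≤ r - c ∨ band m r c))
    (Q := sweeping m 2 0 fun r c => (c = 0 → r < 2) ∧ ¬ (r = 2 * m - 2 ∧ c = 1) ∧
        (3 ≤ r - c ∨ band m r c)) (dr := -1) (dc := 0) (r := 2 * m - 4) (c := 0) (by decide) k
    (by unfold sweeping; omega) (by omega) (by omega)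
    (by intro i _ _; unfold sweeping; omega)
    (by intro i _ _; unfold sweeping band; omega)
    (by
      intro x y _ _ _ h
      have := h (2 * m - 4 - x)
      unfold sweeping
      grind)
  have e : (some (2 * m - 2 + 2 * -1, 0 + 2 * 0) : Option Hole) = some (2 * m - 4, 0) :=
    some_hole_congr (by omega) (by omega)
  rw [e] at h1
  exact (h1.trans h2).cast rfl (some_hole_congr (by omega) (by omega))

theorem reach_turn {n : ℕ} {m : ℤ} (hn : (n : ℤ) = 2 * m) (hm : 6 ≤ m) :
    Reach n (board n (sweeping m 2 0 fun r c => (c = 0 → r < 2) ∧ ¬ (r = 2 * m - 2 ∧ c = 1) ∧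
        (3 ≤ r - c ∨ band m r c))) (some (2, 0)) 0
      (board n (sweeping m 6 4 (bandFrom m 6))) (some (6, 4)) := by
  refine Reach.patch_continue (n := n) (t := (6, 4))
    [(0, 0), (1, 0), (2, 0), (1, 1), (2, 2), (3, 3), (4, 4), (5, 4), (6, 4)]
    [(1, 0), (2, 0), (1, 1), (3, 3), (5, 4)] [(6, 4)]
    ⟨(2, 0), (-1, 0)⟩ [⟨(0, 0), (1, 1)⟩, ⟨(2, 2), (1, 1)⟩, ⟨(4, 4), (1, 0)⟩] 0 0
    (by decide) (by decide) (by decide) rfl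
    (by simp only [List.forall_mem_cons]; simp; omega) ?_ ?_ ?_
  · simp only [List.forall_mem_cons]
    simp [sweeping, band]
    constructorm* _ ∧ _ <;> omega
  · simp only [List.forall_mem_cons]
    simp [sweeping, bandFrom, band]
    constructorm* _ ∧ _ <;> omega
  · intro r c _ _ _ h
    simp only [List.mem_cons, Prod.mk.injEq, List.not_mem_nil, or_false] at h
    unfold sweeping bandFrom band
    grind (splits := 40)

theorem sweeping_band {m k R x y r c : ℤ} (hr : 6 * k ≤ r) (hr' : r ≤ 6 * k + 6)
    (hc : r - 2 ≤ c) (hc' : c ≤ r) (hk : 1 ≤ k) (hkm : 3 * k + 6 ≤ m) :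
    sweeping m x y (bandFrom m R) r c ↔ (r = x ∧ c = y) ∨ (R < r ∧ (r = 6 * k + 1 ∨
      (r = 6 * k + 2 ∧ c = r - 1) ∨ r = 6 * k + 3 ∨ (r = 6 * k + 5 ∧ c = r - 1))) := by
  unfold sweeping bandFrom band
  omega

/-- In one period of six rows the band has eight pegs: three in each of the rows `6k + 1` and `6k +
3`, one in each of the rows `6k + 2` and `6k + 5`. The eight jumps capture exactly these and advance
the sweeper by one period. -/
theorem reach_sweepGroups_succ {n : ℕ} {m : ℤ} (hn : (n : ℤ) = 2 * m) {k : ℤ} (hk : 1 ≤ k)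
    (hkm : 3 * k + 6 ≤ m) :
    Reach n (board n (sweeping m (6 * k) (6 * k - 2) (bandFrom m (6 * k))))
      (some (6 * k, 6 * k - 2)) 0
      (board n (sweeping m (6 * (k + 1)) (6 * (k + 1) - 2) (bandFrom m (6 * (k + 1)))))
      (some (6 * (k + 1), 6 * (k + 1) - 2)) := by
  refine (Reach.patch_continue (n := n) (t := (6, 6))
    [(0, 0), (1, 1), (2, 2), (1, 2), (0, 2), (1, 3), (2, 4), (2, 3), (3, 3), (4, 4), (3, 4),
      (3, 5), (4, 6), (5, 6), (6, 6)]
    [(0, 0), (1, 1), (1, 2), (1, 3), (2, 3), (3, 3), (3, 4), (3, 5), (5, 6)] [(6, 6)]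
    ⟨(0, 0), (1, 1)⟩ [⟨(2, 2), (-1, 0)⟩, ⟨(0, 2), (1, 1)⟩, ⟨(2, 4), (0, -1)⟩, ⟨(2, 2), (1, 1)⟩,
      ⟨(4, 4), (-1, 0)⟩, ⟨(2, 4), (1, 1)⟩, ⟨(4, 6), (1, 0)⟩] (6 * k) (6 * k - 2)
    (by decide) (by decide) (by decide) (some_hole_congr (by dsimp; omega) (by dsimp; omega))
    (by simp only [List.forall_mem_cons]; simp; omega) ?_ ?_ ?_).cast rfl
    (some_hole_congr (by dsimp; omega) (by dsimp; omega))
  · simp only [List.forall_mem_cons]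
    refine ⟨?_, ?_, ?_, ?_, ?_, ?_, ?_, ?_, ?_, ?_, ?_, ?_, ?_, ?_, ?_, by simp⟩ <;>
      (refine (sweeping_band (k := k) (by omega) (by omega) (by omega)
        (by omega) hk hkm).trans ?_; simp <;> omega)
  · simp only [List.forall_mem_cons]
    refine ⟨?_, ?_, ?_, ?_, ?_, ?_, ?_, ?_, ?_, ?_, ?_, ?_, ?_, ?_, ?_, by simp⟩ <;>
      (refine (sweeping_band (k := k) (by omega) (by omega) (by omega)
        (by omega) hk hkm).trans ?_; simp <;> omega)
  · intro r c _ _ _ h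
    simp only [List.mem_cons, Prod.mk.injEq, List.not_mem_nil, or_false] at h
    by_cases hb : 6 * k ≤ r ∧ r ≤ 6 * k + 6 ∧ r - 2 ≤ c
    · rw [sweeping_band hb.1 hb.2.1 hb.2.2 (by omega) hk hkm,
        sweeping_band hb.1 hb.2.1 hb.2.2 (by omega) hk hkm]
      grind (splits := 40)
    · have h1 : 3 ≤ r - c ∨ (6 * k < r ↔ 6 * (k + 1) < r) := by omega
      unfold sweeping bandFrom
      grind

end PegSolitaire

namespace PegSolitaire

/-- The pegs at distance at least `D` from the right side that the final sweep still has to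
capture. -/
def farFrom (m D r c : ℤ) : Prop :=
  1 ≤ c ∧ ¬ (r = 2 * m - 2 ∧ c = 1) ∧ D ≤ r - c

theorem reach_sweepGroups {n : ℕ} {m : ℤ} (hn : (n : ℤ) = 2 * m) (K : ℕ) (hK : 3 * (K : ℤ) + 6 = m) :
    Reach n (board n (sweeping m 6 4 (bandFrom m 6))) (some (6, 4)) 0
      (board n (sweeping m (2 * m - 6) (2 * m - 8) (bandFrom m (2 * m - 6))))
      (some (2 * m - 6, 2 * m - 8)) := by
  have h := Reach.iterate (n := n)
    (fun k => board n (sweeping m (6 * (k + 1)) (6 * (k + 1) - 2) (bandFrom m (6 * (k + 1)))))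
    (fun k => some (6 * (k + 1), 6 * (k + 1) - 2)) 0 K (fun k hk => by
      push_cast
      exact reach_sweepGroups_succ hn (k := k + 1) (by omega) (by omega))
  simp only [Nat.cast_zero] at h
  rw [show 6 * ((K : ℤ) + 1) = 2 * m - 6 by omega, show 2 * m - 6 - 2 = 2 * m - 8 by omega] at h
  exact h

theorem sweeping_last {m R x y r c : ℤ} (hm : 6 ≤ m) (hm3 : m % 3 = 0) (hr : 2 * m - 6 ≤ r)
    (hr' : r ≤ 2 * m - 2) (hc : r - 2 ≤ c) (hc' : c ≤ r) :
    sweeping m x y (bandFrom m R) r c ↔ (r = x ∧ c = y) ∨ (R < r ∧ (r = 2 * m - 5 ∨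
      (r = 2 * m - 4 ∧ c = r - 1) ∨ (r = 2 * m - 3 ∧ c = r - 2))) := by
  unfold sweeping bandFrom band
  omega

/-- The last period is cut short by the corner that the opening cleared: five pegs remain in it. -/
theorem reach_sweepLast {n : ℕ} {m : ℤ} (hn : (n : ℤ) = 2 * m) (hm : 6 ≤ m) (hm3 : m % 3 = 0) :
    Reach n (board n (sweeping m (2 * m - 6) (2 * m - 8) (bandFrom m (2 * m - 6))))
      (some (2 * m - 6, 2 * m - 8)) 0
      (board n (sweeping m (2 * m - 2) (2 * m - 4) (farFrom m 3))) (some (2 * m - 2, 2 * m - 4)) := by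
  have e : board n (sweeping m (2 * m - 2) (2 * m - 4) (farFrom m 3)) =
      board n (sweeping m (2 * m - 2) (2 * m - 4) (bandFrom m (2 * m - 2))) :=
    board_congr fun r c _ _ _ => by unfold sweeping bandFrom farFrom; grind
  rw [e]
  refine (Reach.patch_continue (n := n) (t := (4, 4))
    [(0, 0), (1, 1), (2, 2), (1, 2), (0, 2), (1, 3), (2, 4), (2, 3), (3, 3), (4, 4)]
    [(0, 0), (1, 1), (1, 2), (1, 3), (2, 3), (3, 3)] [(4, 4)]
    ⟨(0, 0), (1, 1)⟩ [⟨(2, 2), (-1, 0)⟩, ⟨(0, 2), (1, 1)⟩, ⟨(2, 4), (0, -1)⟩, ⟨(2, 2), (1, 1)⟩]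
    (2 * m - 6) (2 * m - 8)
    (by decide) (by decide) (by decide) (some_hole_congr (by dsimp; omega) (by dsimp; omega))
    (by simp only [List.forall_mem_cons]; simp; omega) ?_ ?_ ?_).cast rfl
    (some_hole_congr (by dsimp; omega) (by dsimp; omega))
  · simp only [List.forall_mem_cons]
    refine ⟨?_, ?_, ?_, ?_, ?_, ?_, ?_, ?_, ?_, ?_, by simp⟩ <;>
      (refine (sweeping_last hm hm3 (by omega) (by omega) (by omega) (by omega)).trans ?_
       simp <;> omega)
  · simp only [List.forall_mem_cons]
    refine ⟨?_, ?_, ?_, ?_, ?_, ?_, ?_, ?_, ?_, ?_, by simp⟩ <;>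
      (refine (sweeping_last hm hm3 (by omega) (by omega) (by omega) (by omega)).trans ?_
       simp <;> omega)
  · intro r c _ _ _ h
    simp only [List.mem_cons, Prod.mk.injEq, List.not_mem_nil, or_false] at h
    by_cases hb : 2 * m - 6 ≤ r ∧ r ≤ 2 * m - 2 ∧ r - 2 ≤ c
    · rw [sweeping_last hm hm3 hb.1 hb.2.1 hb.2.2 (by omega),
        sweeping_last hm hm3 hb.1 hb.2.1 hb.2.2 (by omega)]
      grind (splits := 40)
    · unfold sweeping bandFrom
      grind

/-- The pegs left over when the zigzag along the line at distance `D` from the right side has come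
up to row `R`. -/
def zigzag (m D R r c : ℤ) : Prop :=
  farFrom m D r c ∧ (r - c = D → r ≤ R)

/-- A jump to the left and a jump up both pass over pegs at distance `2d + 1` from the right side,
and together they shift the sweeper by `(-2, -2)`. -/
theorem reach_zigzag_succ {n : ℕ} {m d i : ℤ} (hn : (n : ℤ) = 2 * m) (hd : 1 ≤ d)
    (hi : 0 ≤ i) (hid : i + d + 3 ≤ m) :
    Reach n (board n (sweeping m (2 * m - 2 - 2 * i) (2 * m - 2 - 2 * d - 2 * i)
        (zigzag m (2 * d + 1) (2 * m - 2 - 2 * i))))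
      (some (2 * m - 2 - 2 * i, 2 * m - 2 - 2 * d - 2 * i)) 0
      (board n (sweeping m (2 * m - 2 - 2 * (i + 1)) (2 * m - 2 - 2 * d - 2 * (i + 1))
        (zigzag m (2 * d + 1) (2 * m - 2 - 2 * (i + 1)))))
      (some (2 * m - 2 - 2 * (i + 1), 2 * m - 2 - 2 * d - 2 * (i + 1))) := by
  refine (Reach.patch_continue (n := n) (t := (0, 0))
    [(2, 2), (2, 1), (2, 0), (1, 0), (0, 0)] [(2, 2), (2, 1), (1, 0)] [(0, 0)]
    ⟨(2, 2), (0, -1)⟩ [⟨(2, 0), (-1, 0)⟩]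
    (2 * m - 2 - 2 * (i + 1)) (2 * m - 2 - 2 * d - 2 * (i + 1))
    (by decide) (by decide) (by decide) (some_hole_congr (by dsimp; omega) (by dsimp; omega))
    (by simp only [List.forall_mem_cons]; simp; omega) ?_ ?_ ?_).cast rfl
    (some_hole_congr (by dsimp; omega) (by dsimp; omega))
  · simp only [List.forall_mem_cons]
    simp [sweeping, zigzag, farFrom]
    constructorm* _ ∧ _ <;> omega
  · simp only [List.forall_mem_cons]
    simp [sweeping, zigzag, farFrom]
    constructorm* _ ∧ _ <;> omega
  · intro r c _ _ _ h
    simp only [List.mem_cons, Prod.mk.injEq, List.not_mem_nil, or_false] at h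
    unfold sweeping zigzag farFrom
    grind (splits := 40)

theorem reach_zigzag {n : ℕ} {m d : ℤ} (hn : (n : ℤ) = 2 * m) (hd : 1 ≤ d) (hdm : d ≤ m - 3) :
    Reach n (board n (sweeping m (2 * m - 2) (2 * m - 2 - 2 * d) (farFrom m (2 * d + 1))))
      (some (2 * m - 2, 2 * m - 2 - 2 * d)) 0
      (board n (sweeping m (2 * d + 2) 0 (farFrom m (2 * d + 2)))) (some (2 * d + 2, 0)) := by
  obtain ⟨K, hK⟩ : ∃ K : ℕ, (K : ℤ) = m - 2 - d := ⟨(m - 2 - d).toNat, by omega⟩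
  have h := Reach.iterate (n := n)
    (fun i => board n (sweeping m (2 * m - 2 - 2 * i) (2 * m - 2 - 2 * d - 2 * i)
        (zigzag m (2 * d + 1) (2 * m - 2 - 2 * i))))
    (fun i => some (2 * m - 2 - 2 * i, 2 * m - 2 - 2 * d - 2 * i)) 0 K (fun i hi => by
      push_cast
      exact reach_zigzag_succ hn hd (by omega) (by omega))
  simp only [Nat.cast_zero, mul_zero, sub_zero] at h
  rw [show 2 * m - 2 - 2 * (K : ℤ) = 2 * d + 2 by omega,
    show 2 * m - 2 - 2 * d - 2 * (K : ℤ) = 2 by omega,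
    board_congr (P := sweeping m (2 * m - 2) (2 * m - 2 - 2 * d)
      (zigzag m (2 * d + 1) (2 * m - 2))) (Q := sweeping m (2 * m - 2) (2 * m - 2 - 2 * d)
      (farFrom m (2 * d + 1))) (fun r c _ _ _ => by unfold sweeping zigzag; grind)] at h
  refine (h.trans (Reach.jump (n := n) (p := some (2 * d + 2, 2)) (k := 0) (2 * d + 2) 2 0 (-1)
    (by decide) (if_pos rfl) ?_ ?_ ?_ ?_)).cast (by omega) (some_hole_congr (by omega) (by omega))
  · unfold sweeping; omega
  · unfold sweeping zigzag farFrom; omega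
  · unfold sweeping zigzag farFrom; omega
  · intro x y _ _ _
    unfold sweeping zigzag farFrom
    grind (splits := 40)

/-- Running down the line at even distance `2d`, the sweeper captures the pegs with both coordinates
odd. -/
theorem reach_line {n : ℕ} {m d : ℤ} (hn : (n : ℤ) = 2 * m) (hd : 2 ≤ d) (hdm : d ≤ m - 3) :
    Reach n (board n (sweeping m (2 * d) 0 (farFrom m (2 * d)))) (some (2 * d, 0)) 0
      (board n (sweeping m (2 * m - 2) (2 * m - 2 - 2 * d) (farFrom m (2 * d + 1))))
      (some (2 * m - 2, 2 * m - 2 - 2 * d)) := by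
  obtain ⟨k, hk⟩ : ∃ k : ℕ, (k : ℤ) = m - 1 - d := ⟨(m - 1 - d).toNat, by omega⟩
  refine (Reach.sweep (n := n) (P := sweeping m (2 * d) 0 (farFrom m (2 * d)))
    (Q := sweeping m (2 * m - 2) (2 * m - 2 - 2 * d) (farFrom m (2 * d + 1)))
    (dr := 1) (dc := 1) (r := 2 * d) (c := 0) (by decide) k
    (by unfold sweeping; omega) (by omega) (by omega)
    (by intro i _ _; unfold sweeping farFrom; omega)
    (by intro i _ _; unfold sweeping farFrom; omega) ?_).cast rfl
    (some_hole_congr (by omega) (by omega))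
  intro x y _ _ _ h
  have := h y
  unfold sweeping farFrom
  grind

theorem reach_lines {n : ℕ} {m : ℤ} (hn : (n : ℤ) = 2 * m) (D : ℕ) (hD : 1 ≤ D)
    (hDm : (D : ℤ) ≤ m - 3) :
    Reach n (board n (sweeping m (2 * m - 2) (2 * m - 4) (farFrom m 3)))
      (some (2 * m - 2, 2 * m - 4)) 0
      (board n (sweeping m (2 * D + 2) 0 (farFrom m (2 * D + 2)))) (some (2 * D + 2, 0)) := by
  induction D, hD using Nat.le_induction with
  | base =>
    have h := reach_zigzag (d := 1) hn le_rfl hDm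
    rw [show 2 * m - 2 - 2 * 1 = 2 * m - 4 by omega] at h
    exact h
  | succ D hD ih =>
    push_cast at hDm ⊢
    have h1 := reach_line (d := D + 1) hn (by omega) hDm
    have h2 := reach_zigzag (d := D + 1) hn (by omega) hDm
    rw [show 2 * ((D : ℤ) + 1) = 2 * D + 2 by ring] at h1 h2 ⊢
    exact ((ih (by omega)).trans h1).trans h2

/-- The two pegs kept in the left corner finish the game: one jumps over the other, and in the same
move captures the sweeper. -/
theorem reach_final {n : ℕ} {m : ℤ} (hn : (n : ℤ) = 2 * m) (hm : 6 ≤ m) :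
    Reach n (board n (sweeping m (2 * m - 4) 0 (farFrom m (2 * m - 4)))) (some (2 * m - 4, 0)) 1
      (board n fun r c => r = 2 * m - 3 ∧ c = 2) (some (2 * m - 3, 2)) := by
  have h1 := Reach.jump (n := n) (P := sweeping m (2 * m - 4) 0 (farFrom m (2 * m - 4)))
    (Q := fun r c => (r = 2 * m - 2 ∧ c = 2) ∨ (r = 2 * m - 1 ∧ (c = 0 ∨ c = 1)))
    (p := some (2 * m - 4, 0)) (k := 0) (2 * m - 4) 0 1 1
    (by decide) (if_pos rfl) (by unfold sweeping; omega) (by unfold sweeping farFrom; omega)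
    (by unfold sweeping farFrom; omega) (by unfold sweeping farFrom; omega)
  have h2 := Reach.jump (n := n)
    (P := fun r c => (r = 2 * m - 2 ∧ c = 2) ∨ (r = 2 * m - 1 ∧ (c = 0 ∨ c = 1)))
    (Q := fun r c => (r = 2 * m - 2 ∧ c = 2) ∨ (r = 2 * m - 1 ∧ c = 2))
    (p := some (2 * m - 4 + 2 * 1, 0 + 2 * 1)) (k := 1) (2 * m - 1) 0 0 1
    (by decide) (if_neg (by simp)) (by omega) (by omega) (by omega) (by omega)
  have h3 := Reach.jump (n := n)
    (P := fun r c => (r = 2 * m - 2 ∧ c = 2) ∨ (r = 2 * m - 1 ∧ c = 2))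
    (Q := fun r c => r = 2 * m - 3 ∧ c = 2)
    (p := some (2 * m - 1 + 2 * 0, 0 + 2 * 1)) (k := 0) (2 * m - 1) 2 (-1) 0
    (by decide) (if_pos (by simp)) (by omega) (by omega) (by omega) (by omega)
  exact ((h1.trans h2).trans h3).cast rfl (some_hole_congr (by omega) (by omega))

theorem triangle_erase {n : ℕ} {r c : ℤ} :
    (triangle n).erase (r, c) = board n fun x y => ¬ (x = r ∧ y = c) := by
  ext ⟨x, y⟩
  rw [mem_board, Finset.mem_erase, mem_triangle]
  simp only [ne_eq, Prod.mk.injEq]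
  tauto

theorem singleton_eq_board {n : ℕ} {r c : ℤ} (h : (r, c) ∈ triangle n) :
    {(r, c)} = board n fun x y => x = r ∧ y = c := by
  ext ⟨x, y⟩
  rw [mem_triangle] at h
  rw [mem_board, Finset.mem_singleton, Prod.mk.injEq]
  constructor
  · rintro ⟨rfl, rfl⟩
    exact ⟨h, rfl, rfl⟩
  · exact fun h => h.2

/-- The general scheme of solutions of `Triangle(6K)`. -/
theorem exists_solution_six_mul (K s : ℕ) (hK : 2 ≤ K) (hs : s + 4 ≤ 3 * K) :
    ∃ k : ℕ, 2 * k = 3 * K * (3 * K + 1) + 8 * K + 6 + 2 * s ∧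
      Reach (6 * K) ((triangle (6 * K)).erase (6 * K - 1, 6 * K - 3)) none k {((6 * K - 3 : ℤ), (2 : ℤ))}
        (some (6 * K - 3, 2)) := by
  obtain ⟨m, hm⟩ : ∃ m : ℤ, m = 3 * K := ⟨_, rfl⟩
  have hn : ((6 * K : ℕ) : ℤ) = 2 * m := by push_cast; omega
  have hm6 : 6 ≤ m := by omega
  have hm3 : m % 3 = 0 := by omega
  obtain ⟨J, hJ⟩ : ∃ J : ℕ, (J : ℤ) = m - 3 := ⟨(m - 3).toNat, by omega⟩
  obtain ⟨L, hL⟩ : ∃ L : ℕ, L + 1 = K := ⟨K - 1, by omega⟩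
  obtain ⟨M, hM⟩ : ∃ M : ℕ, M + 2 = K := ⟨K - 2, by omega⟩
  obtain ⟨t, ht⟩ : ∃ t : ℕ, (t : ℤ) = m - 1 + s := ⟨(m - 1 + s).toNat, by omega⟩
  have h1 := (reach_afterOpening hn hm6).trans (reach_afterDiagonal hn hm6 hJ)
  have h2 := h1.trans (reach_afterGroups hn (K := L) (by omega) (by omega))
  rw [show (L : ℤ) = m / 3 - 1 by omega, show 6 * (m / 3 - 1) + 2 = 2 * m - 4 by omega,
    show 6 * (m / 3 - 1) = 2 * m - 6 by omega] at h2
  obtain ⟨C, hC, h3⟩ := reach_afterColumns hn hm3 J (by omega)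
  rw [if_neg (by omega), hJ] at h3
  rw [hJ] at hC
  have h4 := (h2.trans h3).trans (reach_afterTop hn hm6 (by
    simp only [ne_eq, Option.some.injEq, Prod.mk.injEq]; omega))
  have h5 := (h4.trans (reach_afterHops hn hm6 hm3 s t (by omega) ht)).trans
    (reach_beforeSweep hn hm6 hm3)
  have h6 := ((h5.trans (reach_column hn hm6)).trans (reach_turn hn hm6)).trans
    (reach_sweepGroups hn M (by omega))
  have h7 := (h6.trans (reach_sweepLast hn hm6 hm3)).trans (reach_lines hn J (by omega) (by omega))
  rw [show 2 * (J : ℤ) + 2 = 2 * m - 4 by omega] at h7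
  have h8 := h7.trans (reach_final hn hm6)
  have e1 : ((6 * K - 1, 6 * K - 3) : Hole) = (2 * m - 1, 2 * m - 3) :=
    Prod.ext (by dsimp only; omega) (by dsimp only; omega)
  have e2 : ((6 * K - 3, 2) : Hole) = (2 * m - 3, 2) :=
    Prod.ext (by dsimp only; omega) rfl
  rw [e1, e2, triangle_erase, singleton_eq_board (n := 6 * K) (mem_triangle.2 (by omega))]
  refine ⟨_, ?_, h8⟩
  zify
  have hL' : (L : ℤ) = K - 1 := by omega
  rw [hJ, ht, hL']
  subst hm
  linear_combination hC

end PegSolitaire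

/-! ### Counting captures; the solutions on `Triangle(12i)` -/

namespace PegSolitaire

theorem Plays.card_add_length {n : ℕ} {B B' : Finset Hole} {l : List Jump}
    (h : Plays n B l B') : B'.card + l.length = B.card := by
  induction h with
  | nil => simp
  | @cons B B' j l hj _ ih =>
    obtain ⟨hd, hs, ho, _, ht⟩ := hj
    have hne : j.over ≠ j.src := by
      intro e
      have h0 : j.dir = 0 := by simpa [Jump.over] using e
      rw [h0] at hd
      revert hd
      decide
    have h1 : j.over ∈ B.erase j.src := Finset.mem_erase.2 ⟨hne, ho⟩
    have h2 : j.tgt ∉ (B.erase j.src).erase j.over := fun h =>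
      ht (Finset.mem_of_mem_erase (Finset.mem_of_mem_erase h))
    have e1 := Finset.card_erase_add_one hs
    have e2 := Finset.card_erase_add_one h1
    rw [Jump.result, Finset.card_insert_of_notMem h2] at ih
    rw [List.length_cons]
    omega

theorem two_mul_card_triangle (n : ℕ) : 2 * (triangle n).card = n * (n + 1) := by
  induction n with
  | zero => simp [triangle]
  | succ n ih =>
    have e : triangle (n + 1) =
        triangle n ∪ (Finset.Ico (0 : ℤ) (n + 1 : ℕ)).image fun c => ((n : ℤ), c) := by
      ext ⟨r, c⟩
      simp only [Finset.mem_union, mem_triangle, Finset.mem_image, Finset.mem_Ico, Prod.mk.injEq]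
      constructor
      · intro h
        by_cases hr : r < n
        · exact Or.inl ⟨h.1, h.2.1, hr⟩
        · exact Or.inr ⟨c, by omega, by omega, rfl⟩
      · rintro (h | ⟨c', h, rfl, rfl⟩) <;> push_cast at * <;> omega
    rw [e, Finset.card_union_of_disjoint, Finset.card_image_of_injective, mul_add, ih]
    · simp
      ring
    · intro a b h
      simpa using h
    · rw [Finset.disjoint_left]
      rintro ⟨r, c⟩ h h'
      simp only [mem_triangle, Finset.mem_image, Prod.mk.injEq] at h h'
      obtain ⟨_, _, h', _⟩ := h'
      omega

theorem IsSolution.length_add_two {n : ℕ} {v f : Hole} {l : List Jump} (h : IsSolution n v f l) :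
    l.length + 2 = (triangle n).card := by
  have h1 := h.2.2.card_add_length
  have h2 := Finset.card_erase_add_one h.1
  rw [Finset.card_singleton] at h1
  omega

theorem Reach.exists_isSolution {n k : ℕ} {v f : Hole} {p : Option Hole}
    (h : Reach n ((triangle n).erase v) none k {f} p) (hv : v ∈ triangle n)
    (hf : f ∈ triangle n) : ∃ l, IsSolution n v f l ∧ numMoves l = k := by
  obtain ⟨l, h1, h2, _⟩ := h
  exact ⟨l, ⟨hv, hf, h1⟩, by rw [numMoves_eq_movesAfter, h2]⟩

/-- The holes of `Triangle(12)`. -/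
def holesTwelve : List Hole :=
  (List.range 12).flatMap fun r => (List.range (r + 1)).map fun c : ℕ => ((r : ℤ), (c : ℤ))

theorem mem_holesTwelve {r c : ℤ} : (r, c) ∈ holesTwelve ↔ 0 ≤ c ∧ c ≤ r ∧ r < 12 := by
  simp only [holesTwelve, List.mem_flatMap, List.mem_range, List.mem_map, Prod.mk.injEq]
  constructor
  · rintro ⟨a, h1, b, h2, rfl, rfl⟩
    omega
  · intro h
    exact ⟨r.toNat, by omega, c.toNat, by omega, by omega, by omega⟩

/-- A solution of `Triangle(12)` with 29 moves, without its first jump. -/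
def jumpsTwelve : List Jump :=
  [
      ⟨(3, 0), (-1, 0)⟩, ⟨(5, 0), (-1, 0)⟩, ⟨(7, 0), (-1, 0)⟩, ⟨(9, 0), (-1, 0)⟩, ⟨(11, 0), (-1,
      0)⟩, ⟨(6, 2), (0, -1)⟩, ⟨(6, 0), (1, 0)⟩, ⟨(8, 0), (1, 0)⟩, ⟨(11, 2), (0, -1)⟩, ⟨(11, 0),
      (-1, 0)⟩, ⟨(6, 4), (0, -1)⟩, ⟨(8, 3), (-1, -1)⟩, ⟨(6, 1), (0, 1)⟩, ⟨(9, 2), (-1, 0)⟩, ⟨(7,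
      2), (0, -1)⟩, ⟨(11, 4), (0, -1)⟩, ⟨(11, 2), (-1, 0)⟩, ⟨(8, 5), (0, -1)⟩, ⟨(10, 4), (-1,
      0)⟩, ⟨(8, 4), (0, -1)⟩, ⟨(8, 2), (1, 1)⟩, ⟨(8, 6), (-1, -1)⟩, ⟨(6, 4), (1, 0)⟩, ⟨(11, 6),
      (0, -1)⟩, ⟨(11, 4), (-1, 0)⟩, ⟨(9, 4), (-1, 0)⟩, ⟨(4, 4), (1, 0)⟩, ⟨(6, 4), (1, 0)⟩, ⟨(9,
      6), (0, -1)⟩, ⟨(9, 4), (-1, 0)⟩, ⟨(11, 8), (0, -1)⟩, ⟨(11, 6), (-1, 0)⟩, ⟨(2, 2), (1, 1)⟩,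
      ⟨(5, 5), (-1, -1)⟩, ⟨(7, 7), (-1, -1)⟩, ⟨(5, 5), (1, 0)⟩, ⟨(9, 9), (-1, -1)⟩, ⟨(11, 11),
      (-1, -1)⟩, ⟨(10, 8), (-1, -1)⟩, ⟨(8, 6), (1, 0)⟩, ⟨(11, 10), (0, -1)⟩, ⟨(11, 8), (-1,
      -1)⟩, ⟨(9, 6), (1, 0)⟩, ⟨(11, 6), (-1, -1)⟩, ⟨(6, 3), (1, 1)⟩, ⟨(4, 2), (-1, -1)⟩, ⟨(2,
      0), (0, 1)⟩, ⟨(2, 2), (1, 0)⟩, ⟨(4, 2), (1, 1)⟩, ⟨(6, 4), (1, 1)⟩, ⟨(8, 6), (0, 1)⟩, ⟨(8,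
      8), (1, 0)⟩, ⟨(10, 8), (0, 1)⟩, ⟨(10, 10), (-1, -1)⟩, ⟨(8, 8), (-1, -1)⟩, ⟨(6, 6), (1,
      0)⟩, ⟨(8, 6), (0, -1)⟩, ⟨(8, 4), (1, 0)⟩, ⟨(10, 4), (0, -1)⟩, ⟨(10, 2), (0, -1)⟩, ⟨(10,
      0), (-1, 0)⟩, ⟨(8, 0), (1, 1)⟩, ⟨(10, 2), (-1, 0)⟩, ⟨(8, 2), (0, -1)⟩, ⟨(8, 0), (-1, 0)⟩,
      ⟨(6, 0), (-1, 0)⟩, ⟨(4, 0), (0, 1)⟩, ⟨(4, 2), (0, 1)⟩, ⟨(4, 4), (-1, -1)⟩, ⟨(2, 2), (-1,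
      -1)⟩, ⟨(0, 0), (1, 0)⟩, ⟨(2, 0), (1, 0)⟩, ⟨(4, 0), (1, 1)⟩, ⟨(5, 2), (1, 0)⟩, ⟨(7, 2), (0,
      1)⟩]

set_option maxRecDepth 100000 in
theorem runLocal_jumpsTwelve :
    runLocal holesTwelve (holesTwelve.filter (· ≠ (2, 0))) (⟨(0, 0), (1, 0)⟩ :: jumpsTwelve) =
      some [(7, 4)] := by
  decide +kernel

/-- The general scheme needs at least 32 moves on `Triangle(12)`, so the case `i = 1` has its own
solution, verified by computation with the whole board as patch. -/
theorem exists_solution_twelve :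
    ∃ l, IsSolution 12 (2, 0) (7, 4) l ∧ numMoves l = 29 := by
  have hv : ((2, 0) : Hole) ∈ triangle 12 := mem_triangle.2 (by norm_num)
  have hf : ((7, 4) : Hole) ∈ triangle 12 := mem_triangle.2 (by norm_num)
  refine Reach.exists_isSolution (p := some (7, 4)) ?_ hv hf
  rw [triangle_erase, singleton_eq_board hf]
  refine (Reach.patch (n := 12) (t := (7, 4)) holesTwelve _ _ _ _ 0 0 runLocal_jumpsTwelve
    (by decide +kernel) (by decide +kernel) (by simp) ?_ ?_ ?_ ?_).cast rfl rfl
  · rintro ⟨r, c⟩ h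
    simpa using mem_holesTwelve.1 h
  · rintro ⟨r, c⟩ h
    simp [h, imp_iff_not_or]
  · rintro ⟨r, c⟩ h
    simp
  · intro r c h1 h2 h3 h
    rw [sub_zero, sub_zero, mem_holesTwelve] at h
    exact absurd ⟨h1, h2, h3⟩ h

theorem exists_solution_twelve_mul (i : ℕ) (hi : 1 ≤ i) :
    ∃ v f l, IsSolution (12 * i) v f l ∧
      (numMoves l : ℤ) = 18 * (i : ℤ) ^ 2 + 14 * (i : ℤ) - 3 := by
  rcases (show i = 1 ∨ 2 ≤ i by omega) with rfl | h
  · obtain ⟨l, hl, h29⟩ := exists_solution_twelve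
    exact ⟨_, _, l, hl, by rw [h29]; norm_num⟩
  -- With `K = 2i` the scheme has `18i² + 11i + 3 + s` moves, so `s = 3i - 6` gives the required
  -- length.
  · obtain ⟨k, hk, hr⟩ := exists_solution_six_mul (2 * i) (3 * i - 6) (by omega) (by omega)
    obtain ⟨l, hl, hlk⟩ := hr.exists_isSolution
      (mem_triangle.2 (by push_cast; omega)) (mem_triangle.2
        ⟨by norm_num, by push_cast; omega, by push_cast; omega⟩)
    rw [show 6 * (2 * i) = 12 * i by ring] at hl
    refine ⟨_, _, l, hl, ?_⟩
    rw [hlk]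
    zify at hk
    push_cast [Nat.cast_sub (show 6 ≤ 3 * i by omega)] at hk
    exact mul_left_cancel₀ two_ne_zero (by linear_combination hk)

theorem tendsto_avgCaptures {v f : ℕ → Hole} {s : ℕ → List Jump}
    (h : ∀ i : ℕ, 1 ≤ i → IsSolution (12 * i) (v i) (f i) (s i) ∧
      (numMoves (s i) : ℤ) = 18 * (i : ℤ) ^ 2 + 14 * (i : ℤ) - 3) :
    Tendsto (fun i : ℕ => avgCaptures (s i)) atTop (𝓝 4) := by
  -- There are `72i² + 6i - 2` captures; numerator and denominator are divided by `i²`, so the limit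
  -- is `72 / 18`.
  have e : (fun i : ℕ => (72 + 6 * (i : ℝ)⁻¹ - 2 * ((i : ℝ)⁻¹ * (i : ℝ)⁻¹)) /
      (18 + 14 * (i : ℝ)⁻¹ - 3 * ((i : ℝ)⁻¹ * (i : ℝ)⁻¹))) =ᶠ[atTop]
      fun i : ℕ => avgCaptures (s i) := by
    filter_upwards [eventually_ge_atTop 1] with i hi
    obtain ⟨h1, h2⟩ := h i hi
    have h3 := h1.length_add_two
    have h4 := two_mul_card_triangle (12 * i)
    have hl : ((s i).length : ℝ) = 72 * (i : ℝ) ^ 2 + 6 * i - 2 := by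
      have : ((2 * ((s i).length + 2) : ℕ) : ℝ) = (12 * i * (12 * i + 1) : ℕ) := by
        rw [h3, h4]
      push_cast at this
      linarith
    have hm : (numMoves (s i) : ℝ) = 18 * (i : ℝ) ^ 2 + 14 * (i : ℝ) - 3 := by
      exact_mod_cast congrArg (Int.cast : ℤ → ℝ) h2
    have hi0 : (i : ℝ) ≠ 0 := by positivity
    rw [avgCaptures, hl, hm, ← mul_div_mul_right _ _ (pow_ne_zero 2 hi0)]
    congr 1 <;> field_simp
  refine Tendsto.congr' e ?_
  have hi : Tendsto (fun i : ℕ => (i : ℝ)⁻¹) atTop (𝓝 0) := tendsto_inv_atTop_nhds_zero_nat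
  have := ((hi.const_mul 6).const_add 72 |>.sub ((hi.mul hi).const_mul 2)).div
    ((hi.const_mul 14).const_add 18 |>.sub ((hi.mul hi).const_mul 3)) (by norm_num)
  norm_num at this
  exact this

end PegSolitaire

/-! ### The lower bound by hexagons -/

namespace PegSolitaire

/-- The hole `x` lies in the hexagon with centre `(s.1 - 2, s.2 - 1)`. -/
def InHexagon (s x : Hole) : Prop :=
  (-1 ≤ x.1 - (s.1 - 2) ∧ x.1 - (s.1 - 2) ≤ 1) ∧ (-1 ≤ x.2 - (s.2 - 1) ∧ x.2 - (s.2 - 1) ≤ 1) ∧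
    (-1 ≤ x.1 - (s.1 - 2) - (x.2 - (s.2 - 1)) ∧ x.1 - (s.1 - 2) - (x.2 - (s.2 - 1)) ≤ 1)

/-- On the seven offsets of a hexagon the form `r + 2c` takes the values `-3, …, 3`, once each. Two
centres around `x` thus have values differing by at most 6; if these agree mod 7 they are equal, and
so are the offsets. -/
theorem InHexagon.eq {s t x : Hole} (hs : InHexagon s x) (ht : InHexagon t x)
    (h : (s.1 + 2 * s.2) % 7 = (t.1 + 2 * t.2) % 7) : s = t := by
  unfold InHexagon at hs ht
  have e : s.1 + 2 * s.2 = t.1 + 2 * t.2 := by omega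
  exact Prod.ext (by omega) (by omega)

/-- A rim hole has three consecutive neighbours in the hexagon, hence one from each opposite pair;
the centre has all six. -/
theorem Jump.inHexagon_of_over {j : Jump} (hd : j.dir ∈ directions) {s : Hole}
    (h : InHexagon s j.over) : InHexagon s j.src ∨ InHexagon s j.tgt := by
  obtain ⟨⟨r, c⟩, ⟨dr, dc⟩⟩ := j
  simp only [directions, Finset.mem_insert, Finset.mem_singleton, Prod.mk.injEq] at hd
  simp only [InHexagon, Jump.over, Jump.tgt, Prod.mk_add_mk] at h ⊢
  rcases hd with ⟨rfl, rfl⟩ | ⟨rfl, rfl⟩ | ⟨rfl, rfl⟩ | ⟨rfl, rfl⟩ | ⟨rfl, rfl⟩ | ⟨rfl, rfl⟩ <;>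
    omega

/-- Every hexagon that is full at first and empty in the end requires a move of its own. -/
theorem card_le_movesAfter {n : ℕ} {l : List Jump} {B B' : Finset Hole} (h : Plays n B l B')
    (hB : B ⊆ triangle n) (p : Option Hole) (S : Finset Hole) (k : ℤ)
    (hk : ∀ s ∈ S, (s.1 + 2 * s.2) % 7 = k)
    (hp : ∀ s ∈ S, ∀ q, p = some q → ¬ InHexagon s q)
    (hne : ∀ s ∈ S, ∃ x ∈ triangle n, InHexagon s x)
    (hfull : ∀ s ∈ S, ∀ x ∈ triangle n, InHexagon s x → x ∈ B)
    (hempty : ∀ s ∈ S, ∀ x ∈ B', ¬ InHexagon s x) : S.card ≤ movesAfter p l := by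
  classical
  induction h generalizing p S with
  | nil B =>
    have : S = ∅ := by
      refine Finset.eq_empty_of_forall_notMem fun s hs => ?_
      obtain ⟨x, hx, hsx⟩ := hne s hs
      exact hempty s hs x (hfull s hs x hx hsx) hsx
    simp [this]
  | @cons B B' j l hj _ ih =>
    obtain ⟨hd, hs, ho, htn, ht⟩ := hj
    -- A jump lands in a vacant hole, whereas the hexagons of `S` are still full.
    have htgt : ∀ s ∈ S, ¬ InHexagon s j.tgt := fun s hsS h => ht (hfull s hsS _ htn h)
    have hsub : j.result B ⊆ triangle n := by
      intro x hx
      rw [Jump.result, Finset.mem_insert] at hx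
      rcases hx with rfl | hx
      · exact htn
      · exact hB (Finset.mem_of_mem_erase (Finset.mem_of_mem_erase hx))
    -- Only hexagons containing the source are dropped. The others stay full: a peg captured in one
    -- of them would force the source or the target into it.
    have h1 := ih hsub (some j.tgt) (S.filter fun s => ¬ InHexagon s j.src)
      (fun s h => hk s (Finset.mem_filter.1 h).1)
      (fun s h q hq => by
        obtain rfl : j.tgt = q := Option.some.inj hq
        exact htgt s (Finset.mem_filter.1 h).1)
      (fun s h => hne s (Finset.mem_filter.1 h).1)
      (fun s h x hx hsx => by
        obtain ⟨hsS, hsrc⟩ := Finset.mem_filter.1 h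
        refine Finset.mem_insert_of_mem (Finset.mem_erase.2 ⟨?_, Finset.mem_erase.2 ⟨?_,
          hfull s hsS x hx hsx⟩⟩)
        · rintro rfl
          exact (Jump.inHexagon_of_over hd hsx).elim hsrc (htgt s hsS)
        · rintro rfl
          exact hsrc hsx)
      (fun s h => hempty s (Finset.mem_filter.1 h).1)
    have h2 := Finset.card_filter_add_card_filter_not (s := S) (fun s => InHexagon s j.src)
    -- If the jump continues a move, its source is the landing `p`, which lies in no hexagon of `S`;
    -- otherwise the source lies in at most one, by disjointness.
    have h3 : (S.filter fun s => InHexagon s j.src).card ≤ if p = some j.src then 0 else 1 := by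
      split_ifs with hps
      · rw [Nat.le_zero, Finset.card_eq_zero, Finset.filter_eq_empty_iff]
        exact fun s hsS => hp s hsS _ hps
      · refine Finset.card_le_one.2 fun a ha b hb => ?_
        obtain ⟨ha, ha'⟩ := Finset.mem_filter.1 ha
        obtain ⟨hb, hb'⟩ := Finset.mem_filter.1 hb
        exact ha'.eq hb' ((hk a ha).trans (hk b hb).symm)
    rw [movesAfter]
    omega

/-- Shifted by `(-2, -1)`, `Triangle(n + 3)` is the board with one further line of points along each
side. All its points except the three corners are in the board or adjacent to it. -/
theorem exists_mem_inHexagon {n : ℕ} (hn : 1 ≤ n) {s : Hole} (hs : s ∈ triangle (n + 3))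
    (h1 : s ≠ (0, 0)) (h2 : s ≠ ((n : ℤ) + 2, 0)) (h3 : s ≠ ((n : ℤ) + 2, (n : ℤ) + 2)) :
    ∃ x ∈ triangle n, InHexagon s x := by
  obtain ⟨r, c⟩ := s
  rw [mem_triangle] at hs
  push_cast at hs
  simp only [ne_eq, Prod.mk.injEq] at h1 h2 h3
  have key : ∀ x y : ℤ, (0 ≤ y ∧ y ≤ x ∧ x < n) → InHexagon (r, c) (x, y) →
      ∃ x ∈ triangle n, InHexagon (r, c) x := fun x y h h' => ⟨(x, y), mem_triangle.2 h, h'⟩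
  unfold InHexagon at *
  dsimp only at *
  rcases (show r = n + 2 ∨ r = 1 ∨ (2 ≤ r ∧ r < n + 2) by omega) with h | h | h
  · by_cases hc : c ≤ n
    · exact key (n - 1) (c - 1) (by omega) (by omega)
    · exact key (n - 1) (n - 1) (by omega) (by omega)
  · exact key 0 0 (by omega) (by omega)
  · rcases (show c = 0 ∨ c = r ∨ (1 ≤ c ∧ c < r) by omega) with hc | hc | hc
    · exact key (r - 2) 0 (by omega) (by omega)
    · exact key (r - 2) (r - 2) (by omega) (by omega)
    · exact key (r - 2) (c - 1) (by omega) (by omega)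

theorem IsSolution.card_le_seven_mul {n : ℕ} {v f : Hole} {l : List Jump}
    (h : IsSolution n v f l) : (triangle n).card ≤ 7 * numMoves l := by
  classical
  have hT := two_mul_card_triangle n
  -- Two lost hexagons cost 14 in the count, which the surplus `3n + 3` covers from `n = 4` on.
  -- Smaller boards have at most 6 holes, so a single move suffices.
  rcases Nat.lt_or_ge n 4 with hn | hn
  · have hlen := h.length_add_two
    have hpos : 1 ≤ numMoves l := by
      cases l with
      | nil =>
        simp only [List.length_nil] at hlen
        interval_cases n <;> omega
      | cons a l => rw [numMoves_cons]; omega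
    interval_cases n <;> omega
  · set E := (((triangle (n + 3)).erase (0, 0)).erase ((n : ℤ) + 2, 0)).erase
      ((n : ℤ) + 2, (n : ℤ) + 2) with hE
    have hEcard : (triangle n).card + 3 * n + 3 = E.card := by
      have e1 := Finset.card_erase_add_one (s := triangle (n + 3)) (a := (0, 0))
        (mem_triangle.2 ⟨le_rfl, le_rfl, by push_cast; omega⟩)
      have e2 := Finset.card_erase_add_one (s := (triangle (n + 3)).erase (0, 0))
        (a := ((n : ℤ) + 2, 0)) (Finset.mem_erase.2 ⟨by
          simp only [ne_eq, Prod.mk.injEq]; omega, mem_triangle.2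
          ⟨le_rfl, by omega, by push_cast; omega⟩⟩)
      have e3 := Finset.card_erase_add_one (s := ((triangle (n + 3)).erase (0, 0)).erase
        ((n : ℤ) + 2, 0)) (a := ((n : ℤ) + 2, (n : ℤ) + 2)) (Finset.mem_erase.2 ⟨by
          simp only [ne_eq, Prod.mk.injEq]; omega, Finset.mem_erase.2 ⟨by
          simp only [ne_eq, Prod.mk.injEq]; omega, mem_triangle.2
          ⟨by omega, le_rfl, by push_cast; omega⟩⟩⟩)
      have e4 := two_mul_card_triangle (n + 3)
      have e5 : (n + 3) * (n + 3 + 1) = n * (n + 1) + 6 * n + 12 := by ring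
      rw [← hE] at e3
      omega
    -- More than `⌊(|E| - 1) / 7⌋` means at least `⌈|E| / 7⌉`; the rounding is taken this way
    -- because the pigeonhole principle is strict.
    obtain ⟨k, -, hk⟩ := Finset.exists_lt_card_fiber_of_mul_lt_card_of_maps_to (s := E)
      (t := Finset.Ico (0 : ℤ) 7) (f := fun s => (s.1 + 2 * s.2) % 7) (n := (E.card - 1) / 7)
      (fun s _ => Finset.mem_Ico.2 (by omega))
      (by rw [Int.card_Ico]; simp; omega)
    set C := E.filter fun s => (s.1 + 2 * s.2) % 7 = k with hC
    have hone : ∀ x, (C.filter fun s => InHexagon s x).card ≤ 1 := fun x =>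
      Finset.card_le_one.2 fun a ha b hb => by
        obtain ⟨ha, ha'⟩ := Finset.mem_filter.1 ha
        obtain ⟨hb, hb'⟩ := Finset.mem_filter.1 hb
        exact ha'.eq hb' ((Finset.mem_filter.1 ha).2.trans (Finset.mem_filter.1 hb).2.symm)
    set S := C.filter fun s => ¬ InHexagon s v ∧ ¬ InHexagon s f with hS
    have hCS : C ⊆ S ∪ ((C.filter fun s => InHexagon s v) ∪ C.filter fun s => InHexagon s f) := by
      intro s hs
      simp only [hS, Finset.mem_union, Finset.mem_filter]
      tauto
    have hcard := (Finset.card_le_card hCS).trans ((Finset.card_union_le _ _).trans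
      (Nat.add_le_add_left (Finset.card_union_le _ _) _))
    have hv := hone v
    have hf := hone f
    have key := card_le_movesAfter h.2.2 (Finset.erase_subset _ _) none S k
      (fun s hs => (Finset.mem_filter.1 (Finset.mem_filter.1 hs).1).2)
      (fun _ _ _ hq => by simp at hq)
      (fun s hs => by
        have hsE := (Finset.mem_filter.1 (Finset.mem_filter.1 hs).1).1
        rw [hE, Finset.mem_erase, Finset.mem_erase, Finset.mem_erase] at hsE
        exact exists_mem_inHexagon (by omega) hsE.2.2.2 hsE.2.2.1 hsE.2.1 hsE.1)
      (fun s hs x hx hsx => Finset.mem_erase.2 ⟨by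
        rintro rfl
        exact (Finset.mem_filter.1 hs).2.1 hsx, hx⟩)
      (fun s hs x hx hsx => by
        rw [Finset.mem_singleton] at hx
        subst hx
        exact (Finset.mem_filter.1 hs).2.2 hsx)
    rw [← numMoves_eq_movesAfter] at key
    omega

theorem IsSolution.avgCaptures_le {n : ℕ} {v f : Hole} {l : List Jump}
    (h : IsSolution n v f l) : avgCaptures l ≤ 7 := by
  have h1 := h.card_le_seven_mul
  have h2 := h.length_add_two
  have h3 : (l.length : ℝ) ≤ 7 * numMoves l := by exact_mod_cast (by omega : l.length ≤ _)
  exact div_le_of_le_mul₀ (by positivity) (by norm_num) h3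

end PegSolitaire

/-! ### Stripping the last rows -/

namespace PegSolitaire

/-- All holes are occupied except `(a, b)` and the holes in the rows from `R` on at distance at
least `x` from the left side. -/
def stripped (R a b x r c : ℤ) : Prop :=
  ¬ (r = a ∧ c = b) ∧ (R ≤ r → c < x)

/-- Three columns of a strip of two rows are removed. -/
theorem exists_plays_strip_two {n : ℕ} {a b x : ℤ} (hx : 3 ≤ x) (hxn : x + 4 ≤ n)
    (ha : a ≤ n - 3) (hb : a = n - 3 → x ≤ b) :
    ∃ l, Plays n (board n (stripped (n - 2) a b x)) l (board n (stripped (n - 2) a b (x - 3))) := by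
  refine ⟨_, Plays.patch
    [(6, 2), (7, 0), (7, 1), (7, 2), (8, 0), (8, 1), (8, 2), (8, 3)]
    [(6, 2), (7, 0), (7, 1), (7, 2), (8, 0), (8, 1), (8, 2)]
    [(6, 2)]
    [⟨(8, 1), (0, 1)⟩, ⟨(6, 2), (1, 0)⟩, ⟨(7, 0), (0, 1)⟩, ⟨(8, 3), (0, -1)⟩,
      ⟨(8, 0), (0, 1)⟩, ⟨(8, 2), (-1, 0)⟩]
    (n - 9) (x - 3)
    (by decide) (by simp only [List.forall_mem_cons]; simp; omega) ?_ ?_ ?_⟩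
  · simp only [List.forall_mem_cons]
    refine ⟨?_, ?_, ?_, ?_, ?_, ?_, ?_, ?_, by simp⟩ <;>
      (simp [stripped]; omega)
  · simp only [List.forall_mem_cons]
    refine ⟨?_, ?_, ?_, ?_, ?_, ?_, ?_, ?_, by simp⟩ <;>
      (simp [stripped]; omega)
  · intro r c _ _ _ h
    simp only [List.mem_cons, Prod.mk.injEq, List.not_mem_nil, or_false] at h
    unfold stripped
    grind (splits := 40)

/-- A column of a strip of three rows is removed. -/
theorem exists_plays_strip_three {n : ℕ} {a b x : ℤ} (hx : 3 ≤ x) (hxn : x + 4 ≤ n)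
    (ha : a ≤ n - 4) :
    ∃ l, Plays n (board n (stripped (n - 3) a b x)) l (board n (stripped (n - 3) a b (x - 1))) := by
  refine ⟨_, Plays.patch
    [(2, 1), (2, 2), (2, 3), (3, 2), (4, 2)]
    [(2, 1), (2, 2), (3, 2), (4, 2)]
    [(2, 1)]
    [⟨(2, 1), (0, 1)⟩, ⟨(4, 2), (-1, 0)⟩, ⟨(2, 3), (0, -1)⟩]
    (n - 5) (x - 3)
    (by decide) (by simp only [List.forall_mem_cons]; simp; omega) ?_ ?_ ?_⟩
  · simp only [List.forall_mem_cons]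
    refine ⟨?_, ?_, ?_, ?_, ?_, by simp⟩ <;>
      (simp [stripped]; omega)
  · simp only [List.forall_mem_cons]
    refine ⟨?_, ?_, ?_, ?_, ?_, by simp⟩ <;>
      (simp [stripped]; omega)
  · intro r c _ _ _ h
    simp only [List.mem_cons, Prod.mk.injEq, List.not_mem_nil, or_false] at h
    unfold stripped
    grind (splits := 40)

/-- Removing a single column borrows a helper peg from the column to its left, which fails at the
edge. The last two columns go together, with the helper `(n - 4, 1)` taken from the row above and
returned. -/
theorem exists_plays_strip_three_end {n : ℕ} {a b : ℤ} (hn : 9 ≤ n) (ha : a = n - 4)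
    (hb : 2 ≤ b) :
    ∃ l, Plays n (board n (stripped (n - 3) a b 2)) l (board n (stripped (n - 3) a b 0)) := by
  refine ⟨_, Plays.patch
    [(5, 1), (6, 0), (6, 1), (6, 2), (7, 0), (7, 1), (7, 3), (8, 0), (8, 1)]
    [(5, 1), (6, 0), (6, 1), (7, 0), (7, 1), (8, 0), (8, 1)]
    [(5, 1)]
    [⟨(6, 0), (0, 1)⟩, ⟨(5, 1), (1, 1)⟩, ⟨(8, 1), (-1, 0)⟩, ⟨(8, 0), (-1, 0)⟩,
      ⟨(6, 0), (0, 1)⟩, ⟨(7, 3), (-1, -1)⟩]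
    (n - 9) 0
    (by decide) (by simp only [List.forall_mem_cons]; simp; omega) ?_ ?_ ?_⟩
  · simp only [List.forall_mem_cons]
    refine ⟨?_, ?_, ?_, ?_, ?_, ?_, ?_, ?_, ?_, by simp⟩ <;>
      (simp [stripped]; omega)
  · simp only [List.forall_mem_cons]
    refine ⟨?_, ?_, ?_, ?_, ?_, ?_, ?_, ?_, ?_, by simp⟩ <;>
      (simp [stripped]; omega)
  · intro r c _ _ _ h
    simp only [List.mem_cons, Prod.mk.injEq, List.not_mem_nil, or_false] at h
    unfold stripped
    grind (splits := 40)

/-- What remains of the last two rows has `n - 5` columns, a multiple of 3 when `n ≡ 2` mod 3, ready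
for removal in threes. The vacancy `(n - 3, n - 5)` becomes that of the smaller board. -/
theorem exists_plays_corner_two {n : ℕ} (hn : 11 ≤ n) :
    ∃ l, Plays n (board n fun r c => ¬ (r = n - 1 ∧ c = n - 1)) l
      (board n (stripped (n - 2) (n - 3) (n - 5) (n - 5))) := by
  refine ⟨_, Plays.patch
    [(8, 5), (8, 6), (8, 7), (8, 8), (9, 6), (9, 7), (9, 8), (9, 9), (10, 6), (10, 7),
      (10, 8), (10, 9), (10, 10)]
    [(8, 5), (8, 6), (8, 7), (8, 8), (9, 6), (9, 7), (9, 8), (9, 9), (10, 6), (10, 7),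
      (10, 8), (10, 9)]
    [(8, 7), (8, 5), (8, 8)]
    [⟨(8, 8), (1, 1)⟩, ⟨(8, 6), (0, 1)⟩, ⟨(10, 8), (-1, -1)⟩, ⟨(8, 5), (0, 1)⟩,
      ⟨(10, 10), (0, -1)⟩, ⟨(10, 6), (-1, 0)⟩, ⟨(10, 7), (0, 1)⟩, ⟨(8, 7), (0, -1)⟩,
      ⟨(10, 9), (-1, -1)⟩]
    (n - 11) (n - 11)
    (by decide) (by simp only [List.forall_mem_cons]; simp; omega) ?_ ?_ ?_⟩
  · simp only [List.forall_mem_cons]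
    refine ⟨?_, ?_, ?_, ?_, ?_, ?_, ?_, ?_, ?_, ?_, ?_, ?_, ?_, by simp⟩ <;>
      (simp; omega)
  · simp only [List.forall_mem_cons]
    refine ⟨?_, ?_, ?_, ?_, ?_, ?_, ?_, ?_, ?_, ?_, ?_, ?_, ?_, by simp⟩ <;>
      (simp [stripped]; omega)
  · intro r c _ _ _ h
    simp only [List.mem_cons, Prod.mk.injEq, List.not_mem_nil, or_false] at h
    unfold stripped
    grind (splits := 40)

/-- Here `n - 4` columns remain, a multiple of 3 when `n ≡ 1` mod 3, and the new vacancy is the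
corner of the smaller board. -/
theorem exists_plays_corner_one {n : ℕ} (hn : 13 ≤ n) :
    ∃ l, Plays n (board n fun r c => ¬ (r = n - 1 ∧ c = n - 3)) l
      (board n (stripped (n - 2) (n - 3) (n - 3) (n - 4))) := by
  refine ⟨_, Plays.patch
    [(9, 9), (10, 9), (10, 10), (11, 9), (11, 10), (11, 11), (12, 9), (12, 10), (12, 11),
      (12, 12)]
    [(9, 9), (10, 9), (10, 10), (11, 9), (11, 10), (11, 11), (12, 9), (12, 11), (12, 12)]
    [(10, 9), (9, 9)]
    [⟨(12, 12), (0, -1)⟩, ⟨(12, 9), (0, 1)⟩, ⟨(10, 9), (1, 0)⟩, ⟨(12, 11), (-1, -1)⟩,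
      ⟨(9, 9), (1, 0)⟩, ⟨(11, 11), (-1, -1)⟩, ⟨(12, 9), (-1, 0)⟩]
    (n - 13) (n - 13)
    (by decide) (by simp only [List.forall_mem_cons]; simp; omega) ?_ ?_ ?_⟩
  · simp only [List.forall_mem_cons]
    refine ⟨?_, ?_, ?_, ?_, ?_, ?_, ?_, ?_, ?_, ?_, by simp⟩ <;>
      (simp; omega)
  · simp only [List.forall_mem_cons]
    refine ⟨?_, ?_, ?_, ?_, ?_, ?_, ?_, ?_, ?_, ?_, by simp⟩ <;>
      (simp [stripped]; omega)
  · intro r c _ _ _ h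
    simp only [List.mem_cons, Prod.mk.injEq, List.not_mem_nil, or_false] at h
    unfold stripped
    grind (splits := 40)

/-- Strips of three rows lose single columns, so no congruence is needed; the vacancy keeps its
place relative to the corner. -/
theorem exists_plays_corner_three {n : ℕ} (hn : 12 ≤ n) :
    ∃ l, Plays n (board n fun r c => ¬ (r = n - 1 ∧ c = n - 3)) l
      (board n (stripped (n - 3) (n - 4) (n - 6) (n - 4))) := by
  refine ⟨_, Plays.patch
    [(8, 6), (9, 7), (9, 8), (9, 9), (10, 8), (10, 9), (10, 10), (11, 7), (11, 8), (11, 9),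
      (11, 10), (11, 11)]
    [(8, 6), (9, 7), (9, 8), (9, 9), (10, 8), (10, 9), (10, 10), (11, 7), (11, 8), (11, 10),
      (11, 11)]
    [(11, 7), (9, 7)]
    [⟨(11, 7), (0, 1)⟩, ⟨(9, 8), (1, 0)⟩, ⟨(8, 6), (1, 1)⟩, ⟨(11, 8), (-1, 0)⟩,
      ⟨(9, 9), (0, -1)⟩, ⟨(11, 11), (-1, -1)⟩, ⟨(11, 10), (0, -1)⟩, ⟨(9, 9), (1, 0)⟩,
      ⟨(11, 9), (0, -1)⟩]
    (n - 12) (n - 12)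
    (by decide) (by simp only [List.forall_mem_cons]; simp; omega) ?_ ?_ ?_⟩
  · simp only [List.forall_mem_cons]
    refine ⟨?_, ?_, ?_, ?_, ?_, ?_, ?_, ?_, ?_, ?_, ?_, ?_, by simp⟩ <;>
      (simp; omega)
  · simp only [List.forall_mem_cons]
    refine ⟨?_, ?_, ?_, ?_, ?_, ?_, ?_, ?_, ?_, ?_, ?_, ?_, by simp⟩ <;>
      (simp [stripped]; omega)
  · intro r c _ _ _ h
    simp only [List.mem_cons, Prod.mk.injEq, List.not_mem_nil, or_false] at h
    unfold stripped
    grind (splits := 40)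

end PegSolitaire

/-! ### Reduction of every board to side `6K`, and the asymptotics -/

namespace PegSolitaire

/-- On `Triangle(n)`, the position `B'` can be reached from the position `B`. -/
def Reduces (n : ℕ) (B B' : Finset Hole) : Prop := ∃ l, Plays n B l B'

theorem Reduces.trans {n : ℕ} {B C D : Finset Hole} (h : Reduces n B C) (h' : Reduces n C D) :
    Reduces n B D := by
  obtain ⟨l, h⟩ := h
  obtain ⟨l', h'⟩ := h'
  exact ⟨l ++ l', h.append h'⟩

theorem triangle_subset {n n' : ℕ} (h : n' ≤ n) : triangle n' ⊆ triangle n := by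
  rintro ⟨r, c⟩ hx
  rw [mem_triangle] at hx ⊢
  omega

theorem Plays.mono {n n' : ℕ} (hn : n' ≤ n) {B B' : Finset Hole} {l : List Jump}
    (h : Plays n' B l B') : Plays n B l B' := by
  induction h with
  | nil B => exact Plays.nil B
  | cons hj _ ih =>
    exact Plays.cons ⟨hj.1, hj.2.1, hj.2.2.1, triangle_subset hn hj.2.2.2.1, hj.2.2.2.2⟩ ih

theorem Reduces.mono {n n' : ℕ} (hn : n' ≤ n) {B B' : Finset Hole} (h : Reduces n' B B') :
    Reduces n B B' := by
  obtain ⟨l, h⟩ := h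
  exact ⟨l, h.mono hn⟩

theorem board_stripped {n n' : ℕ} (hn : n' ≤ n) (a b : ℤ) :
    board n (stripped n' a b 0) = board n' fun r c => ¬ (r = a ∧ c = b) := by
  ext ⟨r, c⟩
  rw [mem_board, mem_board]
  unfold stripped
  omega

theorem reduces_strip_two {n : ℕ} {a b : ℤ} (t : ℕ) (hx : 3 * (t : ℤ) + 4 ≤ n)
    (ha : a ≤ n - 3) (hb : a = n - 3 → 3 * (t : ℤ) ≤ b) :
    Reduces n (board n (stripped (n - 2) a b (3 * t))) (board n (stripped (n - 2) a b 0)) := by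
  induction t with
  | zero => exact ⟨[], Plays.nil _⟩
  | succ t ih =>
    push_cast at *
    have h := exists_plays_strip_two (n := n) (a := a) (b := b) (x := 3 * (t + 1)) (by omega)
      (by omega) ha (by omega)
    rw [show 3 * ((t : ℤ) + 1) - 3 = 3 * t by ring] at h
    exact Reduces.trans h (ih (by omega) (by omega))

theorem reduces_strip_three {n : ℕ} {b : ℤ} (hb : 2 ≤ b) (hn : 9 ≤ n) (t : ℕ)
    (hx : (t : ℤ) + 6 ≤ n) :
    Reduces n (board n (stripped (n - 3) (n - 4) b (t + 2)))
      (board n (stripped (n - 3) (n - 4) b 0)) := by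
  induction t with
  | zero => exact exists_plays_strip_three_end hn rfl hb
  | succ t ih =>
    push_cast at *
    have h := exists_plays_strip_three (n := n) (a := n - 4) (b := b) (x := t + 1 + 2) (by omega)
      (by omega) (by omega)
    rw [show (t : ℤ) + 1 + 2 - 1 = t + 2 by ring] at h
    exact Reduces.trans h (ih (by omega))

theorem reduces_of_mod_three_eq_two {n : ℕ} (hn : 11 ≤ n) (h3 : n % 3 = 2) :
    Reduces n ((triangle n).erase ((n : ℤ) - 1, (n : ℤ) - 1))
      ((triangle (n - 2)).erase ((n : ℤ) - 3, (n : ℤ) - 5)) := by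
  obtain ⟨t, ht⟩ : ∃ t, n = 3 * t + 5 := ⟨(n - 5) / 3, by omega⟩
  have h1 := exists_plays_corner_two hn
  rw [show (n : ℤ) - 5 = 3 * t by omega] at h1 ⊢
  have h2 := Reduces.trans h1 (reduces_strip_two t (by omega) le_rfl (by omega))
  rw [show (n : ℤ) - 2 = (n - 2 : ℕ) by omega, board_stripped (by omega)] at h2
  rwa [triangle_erase, triangle_erase]

theorem reduces_of_mod_three_eq_one {n : ℕ} (hn : 13 ≤ n) (h3 : n % 3 = 1) :
    Reduces n ((triangle n).erase ((n : ℤ) - 1, (n : ℤ) - 3))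
      ((triangle (n - 2)).erase ((n : ℤ) - 3, (n : ℤ) - 3)) := by
  obtain ⟨t, ht⟩ : ∃ t, n = 3 * t + 4 := ⟨(n - 4) / 3, by omega⟩
  have h1 := exists_plays_corner_one hn
  rw [show (n : ℤ) - 4 = 3 * t by omega] at h1
  have h2 := Reduces.trans h1 (reduces_strip_two t (by omega) le_rfl (by omega))
  rw [show (n : ℤ) - 2 = (n - 2 : ℕ) by omega, board_stripped (by omega)] at h2
  rwa [triangle_erase, triangle_erase]

theorem reduces_three {n : ℕ} (hn : 12 ≤ n) :
    Reduces n ((triangle n).erase ((n : ℤ) - 1, (n : ℤ) - 3))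
      ((triangle (n - 3)).erase ((n : ℤ) - 4, (n : ℤ) - 6)) := by
  obtain ⟨t, ht⟩ : ∃ t, n = t + 6 := ⟨n - 6, by omega⟩
  have h1 := exists_plays_corner_three hn
  have h0 := reduces_strip_three (n := n) (b := n - 6) (by omega) (by omega) t (by omega)
  rw [show (n : ℤ) - 4 = t + 2 by omega] at h1
  rw [show (n : ℤ) - 4 = t + 2 by omega] at h0
  have h2 := Reduces.trans h1 h0
  rw [show (n : ℤ) - 3 = (n - 3 : ℕ) by omega, board_stripped (by omega)] at h2
  rw [triangle_erase, triangle_erase, show (n : ℤ) - 4 = t + 2 by omega,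
    show (n : ℤ) - 3 = (n - 3 : ℕ) by omega]
  exact h2

/-- Two rows lead from `n ≡ 1` to `n ≡ 2`, two more to `n ≡ 0` mod 3, and three more, if necessary,
to a multiple of 6. The vacancy left by each reduction is the one the next requires. At most `2 + 2
+ 3 = 7` rows go. -/
theorem exists_reduces_six_mul (n : ℕ) (hn : 20 ≤ n) :
    ∃ (v : Hole) (K : ℕ), v ∈ triangle n ∧ 2 ≤ K ∧ 6 * K ≤ n ∧ n ≤ 6 * K + 7 ∧
      Reduces n ((triangle n).erase v) ((triangle (6 * K)).erase (6 * K - 1, 6 * K - 3)) := by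
  have zero : ∀ n : ℕ, 16 ≤ n → n % 3 = 0 → ∃ K : ℕ, 2 ≤ K ∧ 6 * K ≤ n ∧ n ≤ 6 * K + 3 ∧
      Reduces n ((triangle n).erase ((n : ℤ) - 1, (n : ℤ) - 3))
        ((triangle (6 * K)).erase (6 * K - 1, 6 * K - 3)) := by
    intro n hn h3
    obtain ⟨K, hK⟩ : ∃ K, n = 6 * K ∨ n = 6 * K + 3 := ⟨n / 6, by omega⟩
    refine ⟨K, by omega, by omega, by omega, ?_⟩
    rcases hK with rfl | rfl
    · push_cast
      exact ⟨[], Plays.nil _⟩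
    · have h := reduces_three (n := 6 * K + 3) (by omega)
      have e1 : ((6 * K + 3 : ℕ) : ℤ) - 4 = 6 * K - 1 := by push_cast; ring
      have e2 : ((6 * K + 3 : ℕ) : ℤ) - 6 = 6 * K - 3 := by push_cast; ring
      rw [e1, e2] at h
      exact h
  have two : ∀ n : ℕ, 18 ≤ n → n % 3 = 2 → ∃ K : ℕ, 2 ≤ K ∧ 6 * K ≤ n ∧ n ≤ 6 * K + 5 ∧
      Reduces n ((triangle n).erase ((n : ℤ) - 1, (n : ℤ) - 1))
        ((triangle (6 * K)).erase (6 * K - 1, 6 * K - 3)) := by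
    intro n hn h3
    obtain ⟨K, h1, h2, h4, h⟩ := zero (n - 2) (by omega) (by omega)
    refine ⟨K, h1, by omega, by omega, ?_⟩
    have h5 := reduces_of_mod_three_eq_two (n := n) (by omega) h3
    rw [show ((n - 2 : ℕ) : ℤ) - 1 = n - 3 by omega,
      show ((n - 2 : ℕ) : ℤ) - 3 = n - 5 by omega] at h
    exact h5.trans (h.mono (by omega))
  rcases (show n % 3 = 0 ∨ n % 3 = 1 ∨ n % 3 = 2 by omega) with h3 | h3 | h3
  · obtain ⟨K, h1, h2, h4, h⟩ := zero n (by omega) h3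
    exact ⟨_, K, mem_triangle.2 (by omega), h1, h2, by omega, h⟩
  · obtain ⟨K, h1, h2, h4, h⟩ := two (n - 2) (by omega) (by omega)
    refine ⟨((n : ℤ) - 1, (n : ℤ) - 3), K, mem_triangle.2 (by omega), h1, by omega, by omega, ?_⟩
    have h5 := reduces_of_mod_three_eq_one (n := n) (by omega) h3
    rw [show ((n - 2 : ℕ) : ℤ) - 1 = n - 3 by omega] at h
    exact h5.trans (h.mono (by omega))
  · obtain ⟨K, h1, h2, h4, h⟩ := two n (by omega) h3
    exact ⟨_, K, mem_triangle.2 (by omega), h1, h2, by omega, h⟩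

theorem movesAfter_le_length (p : Option Hole) (l : List Jump) : movesAfter p l ≤ l.length := by
  induction l generalizing p with
  | nil => exact le_rfl
  | cons j l ih =>
    have := ih (some j.tgt)
    rw [movesAfter, List.length_cons]
    split_ifs <;> omega

theorem movesAfter_le_none (p : Option Hole) (l : List Jump) :
    movesAfter p l ≤ movesAfter none l := by
  cases l with
  | nil => exact le_rfl
  | cons j l =>
    rw [movesAfter, movesAfter, if_neg (by simp : ¬ (none : Option Hole) = some j.src)]
    split_ifs <;> omega

theorem exists_short_solution (n : ℕ) (hn : 20 ≤ n) :
    ∃ v f l, IsSolution n v f l ∧ 8 * numMoves l ≤ n ^ 2 + 80 * n := by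
  obtain ⟨v, K, hv, hK, hKn, hnK, l, hl⟩ := exists_reduces_six_mul n hn
  -- The shortest variant of the scheme, `s = 0`.
  obtain ⟨k, hk, l', hl', hm, -⟩ := exists_solution_six_mul K 0 hK (by omega)
  refine ⟨v, (6 * K - 3, 2), l ++ l', ⟨hv, mem_triangle.2 ⟨by norm_num, by omega, by omega⟩,
    hl.append (hl'.mono hKn)⟩, ?_⟩
  have h1 := hl.card_add_length
  have h2 := Finset.card_erase_add_one hv
  have h3 := Finset.card_erase_add_one (s := triangle (6 * K)) (a := (6 * K - 1, 6 * K - 3))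
    (mem_triangle.2 ⟨by omega, by omega, by push_cast; omega⟩)
  have h4 := two_mul_card_triangle n
  have h5 := two_mul_card_triangle (6 * K)
  -- Each stripping jump is counted as a move of its own; joining the two lists can only merge
  -- moves.
  have h6 := movesAfter_le_length none l
  have h7 := movesAfter_le_none (lastLanding none l) l'
  have h8 : numMoves (l ++ l') = movesAfter none l + movesAfter (lastLanding none l) l' := by
    rw [numMoves_eq_movesAfter, movesAfter_append]
  have h9 : 2 * numMoves (l ++ l') ≤
      2 * ((triangle n).card - (triangle (6 * K)).card) + 2 * k := by omega
  obtain ⟨d, rfl⟩ : ∃ d, n = 6 * K + d := ⟨n - 6 * K, by omega⟩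
  have h10 : 2 * ((triangle (6 * K + d)).card - (triangle (6 * K)).card) =
      12 * K * d + d * d + d := by
    rw [Nat.mul_sub, h4, h5]
    have : (6 * K + d) * (6 * K + d + 1) = 6 * K * (6 * K + 1) + (12 * K * d + d * d + d) := by
      ring
    omega
  have hd : d ≤ 7 := by omega
  have e1 : K * d ≤ K * 7 := Nat.mul_le_mul_left K hd
  have e2 : d * d ≤ 7 * d := Nat.mul_le_mul_right d hd
  nlinarith

theorem exists_isShortestOn {n : ℕ} {v f : Hole} {l : List Jump} (h : IsSolution n v f l) :
    ∃ l, IsShortestOn n l := by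
  classical
  have hex : ∃ k, ∃ v f l, IsSolution n v f l ∧ numMoves l = k := ⟨_, v, f, l, h, rfl⟩
  obtain ⟨v', f', l', h', hk⟩ := Nat.find_spec hex
  exact ⟨l', ⟨v', f', h'⟩, fun v f l hl => hk ▸ Nat.find_min' hex ⟨v, f, l, hl, rfl⟩⟩

/-- Eight times the number of moves is at most `n² + 80n`, and twice the number of captures is `n² +
n - 4`. The excess of order `320n` is absorbed by `εn² ≥ 400n`. -/
theorem le_avgCaptures {n : ℕ} (hn : 20 ≤ n) {ε : ℝ} (hε : 400 ≤ ε * n)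
    {l : List Jump} (h : IsShortestOn n l) : 4 - ε ≤ avgCaptures l := by
  obtain ⟨⟨v, f, hl⟩, hmin⟩ := h
  obtain ⟨v', f', l', hl', hle⟩ := exists_short_solution n hn
  have h1 := hl.length_add_two
  have h2 := two_mul_card_triangle n
  have h3 := hl.card_le_seven_mul
  have h4 := hmin v' f' l' hl'
  have hpos : 0 < numMoves l := by nlinarith
  have hN : (8 : ℝ) * numMoves l ≤ n ^ 2 + 80 * n := by
    exact_mod_cast (by omega : 8 * numMoves l ≤ n ^ 2 + 80 * n)
  have hL : 2 * (l.length : ℝ) + 4 = n * (n + 1) := by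
    exact_mod_cast (by omega : 2 * l.length + 4 = n * (n + 1))
  have hn' : (20 : ℝ) ≤ n := by exact_mod_cast hn
  have hm : (0 : ℝ) < numMoves l := by exact_mod_cast hpos
  rw [avgCaptures, le_div_iff₀ hm]
  rcases le_or_gt 4 ε with h4' | h4'
  · have : (4 - ε) * (numMoves l : ℝ) ≤ 0 := mul_nonpos_of_nonpos_of_nonneg (by linarith) hm.le
    exact this.trans (by positivity)
  · have e1 : (4 - ε) * (8 * numMoves l) ≤ (4 - ε) * ((n : ℝ) ^ 2 + 80 * n) :=
      mul_le_mul_of_nonneg_left hN (by linarith)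
    have e2 : 400 * (n : ℝ) ≤ ε * n * n := mul_le_mul_of_nonneg_right hε (by linarith)
    have e3 : 0 ≤ ε * n := by linarith
    nlinarith

end PegSolitaire

theorem mainTheorem6 :
    -- no solution is shorter than the number of holes divided by 7,
    -- and no solution captures more than 7 pegs per move on average
    (∀ (n : ℕ) (v f : Hole) (l : List PegSolitaire.Jump),
      PegSolitaire.IsSolution n v f l →
        ((PegSolitaire.triangle n).card : ℝ) / 7 ≤ (PegSolitaire.numMoves l : ℝ) ∧
        PegSolitaire.avgCaptures l ≤ 7) ∧
    -- solutions on Triangle(12 i) of length 18 i ^ 2 + 14 i - 3,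
    -- which average asymptotically 4 captures per move
    (∃ (v f : ℕ → Hole) (s : ℕ → List PegSolitaire.Jump),
      (∀ i : ℕ, 1 ≤ i →
        PegSolitaire.IsSolution (12 * i) (v i) (f i) (s i) ∧
        (PegSolitaire.numMoves (s i) : ℤ) = 18 * (i : ℤ) ^ 2 + 14 * (i : ℤ) - 3) ∧
      Tendsto (fun i : ℕ => PegSolitaire.avgCaptures (s i)) atTop (𝓝 4)) ∧
    -- on large boards the shortest solutions average between 4 and 7 captures per move
    (∀ ε : ℝ, 0 < ε → ∃ N : ℕ, ∀ n : ℕ, N ≤ n →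
      (∃ l : List PegSolitaire.Jump, PegSolitaire.IsShortestOn n l) ∧
      ∀ l : List PegSolitaire.Jump, PegSolitaire.IsShortestOn n l →
        4 - ε ≤ PegSolitaire.avgCaptures l ∧ PegSolitaire.avgCaptures l ≤ 7) := by
  refine ⟨fun n v f l h => ⟨?_, h.avgCaptures_le⟩, ?_, fun ε hε => ?_⟩
  · rw [div_le_iff₀ (by norm_num), mul_comm]
    exact_mod_cast h.card_le_seven_mul
  · choose! v f s h using PegSolitaire.exists_solution_twelve_mul
    exact ⟨v, f, s, h, PegSolitaire.tendsto_avgCaptures h⟩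
  · refine ⟨max 20 ⌈400 / ε⌉₊, fun n hn => ⟨?_, fun l hl => ⟨?_, ?_⟩⟩⟩
    · obtain ⟨_, _, _, h, _⟩ := PegSolitaire.exists_short_solution n (le_of_max_le_left hn)
      exact PegSolitaire.exists_isShortestOn h
    · refine PegSolitaire.le_avgCaptures (le_of_max_le_left hn) ?_ hl
      have h1 : (⌈400 / ε⌉₊ : ℝ) ≤ n := by exact_mod_cast le_of_max_le_right hn
      have h2 := (Nat.le_ceil (400 / ε)).trans h1
      rw [div_le_iff₀ hε] at h2
      linarith
    · obtain ⟨⟨_, _, h⟩, _⟩ := hl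
      exact h.avgCaptures_le
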